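/- Let $N\in\mathbb N$, $1<p<N$, $0\le\mu<\bar\mu:=\left(\frac{N-p}{p}\right)^p$, $m\in\mathbb R$, and let $f:\mathbb R\to\mathbb R$ be continuous and such that, for some $q>p$ and some $A>0$, $$\limsup_{t\to0}\frac{|f(t)|}{|t|^{q-1}}\le A\qquad\text{and}\qquad \limsup_{|t|\to\infty}\frac{|f(t)|}{|t|^{p^*-1}}\le A,\qquad p^*=\frac{Np}{N-p}.$$ Let $u\in W^{1,p}(\mathbb R^N)$ be a weak solution of $$-\Delta_p u-\frac{\mu}{|x|^p}|u|^{p-2}u+m|u|^{p-2}u=f(u)\quad\text{in }\mathbb R^N,$$ that is, for every nonnegative $\varphi\in C_0^\infty(\mathbb R^N)$, $$\int_{\mathbb R^N}\Big(|\nabla u|^{p-2}\nabla u\cdot\nabla\varphi-\frac{\mu}{|x|^p}|u|^{p-2}u\varphi+m|u|^{p-2}u\varphi\Big)\,dx=\int_{\mathbb R^N}f(u)\varphi\,dx .$$ Suppose that $u$ is positive (almost everywhere) and radial (almost everywhere equal to a function of $|x|$). Then the equation $\gamma^{p-1}\left[(p-1)\gamma-(N-p)\right]+\mu=0$ has a smallest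 solution $\gamma_1$ in $[0,\infty)$, one has $0\le\gamma_1<\frac{N-p}{p}$, and $u$ agrees almost everywhere with a function that is continuous on $\mathbb R^N\setminus\{0\}$ and that, denoted again by $u$, satisfies $$\lim_{|x|\to0}u(x)\,|x|^{\gamma_1}=C$$ for some constant $0<C<\infty$. -/

import Mathlib

open MeasureTheory Filter Topology
open scoped ContDiff

noncomputable section

namespace HardyPLaplace

/-- Test functions: real functions in `C_0^∞(ℝ^N)`. -/
def IsTestFunction {N : ℕ} (φ : EuclideanSpace ℝ (Fin N) → ℝ) : Prop :=
  ContDiff ℝ ∞ φ ∧ HasCompactSupport φ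

/-- `G` is a weak (distributional) gradient of `u` on `ℝ^N`:
`∫ u ∂_v φ = - ∫ (G · v) φ` for every direction `v` and every test function `φ`. -/
def HasWeakGradient {N : ℕ} (u : EuclideanSpace ℝ (Fin N) → ℝ)
    (G : EuclideanSpace ℝ (Fin N) → EuclideanSpace ℝ (Fin N)) : Prop :=
  LocallyIntegrable u ∧ LocallyIntegrable G ∧
    ∀ φ : EuclideanSpace ℝ (Fin N) → ℝ, IsTestFunction φ →
      ∀ v : EuclideanSpace ℝ (Fin N),
        ∫ x, u x * fderiv ℝ φ x v = - ∫ x, inner ℝ (G x) v * φ x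

/-- Membership in the Sobolev space `W^{1,p}(ℝ^N)`. -/
def MemW1p {N : ℕ} (p : ℝ) (u : EuclideanSpace ℝ (Fin N) → ℝ) : Prop :=
  MemLp u (ENNReal.ofReal p) ∧
    ∃ G : EuclideanSpace ℝ (Fin N) → EuclideanSpace ℝ (Fin N),
      HasWeakGradient u G ∧ MemLp G (ENNReal.ofReal p)

/-- The left-hand side of the weak formulation, where `G` is the weak gradient of `u`:
`∫ (|∇u|^{p-2} ∇u · ∇φ - μ |x|^{-p} |u|^{p-2} u φ + m |u|^{p-2} u φ)`.
Here `fderiv ℝ φ x (G x)` is `∇u(x) · ∇φ(x)`. -/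
def weakForm {N : ℕ} (p μ m : ℝ) (u : EuclideanSpace ℝ (Fin N) → ℝ)
    (G : EuclideanSpace ℝ (Fin N) → EuclideanSpace ℝ (Fin N))
    (φ : EuclideanSpace ℝ (Fin N) → ℝ) : ℝ :=
  ∫ x, (‖G x‖ ^ (p - 2) * fderiv ℝ φ x (G x)
    - μ / ‖x‖ ^ p * (|u x| ^ (p - 2) * u x) * φ x
    + m * (|u x| ^ (p - 2) * u x) * φ x)

/-- `u ∈ W^{1,p}(ℝ^N)` is a weak subsolution of
`-Δ_p u - μ |x|^{-p} |u|^{p-2} u + m |u|^{p-2} u = f(u)`.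
The weak gradient is unique up to a null set, so quantifying over all of them is harmless. -/
def IsWeakSubsolution {N : ℕ} (p μ m : ℝ) (f : ℝ → ℝ)
    (u : EuclideanSpace ℝ (Fin N) → ℝ) : Prop :=
  MemW1p p u ∧ ∀ G, HasWeakGradient u G →
    ∀ φ, IsTestFunction φ → (∀ x, 0 ≤ φ x) →
      weakForm p μ m u G φ ≤ ∫ x, f (u x) * φ x

/-- `u ∈ W^{1,p}(ℝ^N)` is a weak supersolution of the same equation. -/
def IsWeakSupersolution {N : ℕ} (p μ m : ℝ) (f : ℝ → ℝ)
    (u : EuclideanSpace ℝ (Fin N) → ℝ) : Prop :=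
  MemW1p p u ∧ ∀ G, HasWeakGradient u G →
    ∀ φ, IsTestFunction φ → (∀ x, 0 ≤ φ x) →
      ∫ x, f (u x) * φ x ≤ weakForm p μ m u G φ

/-- Weak solutions are functions that are both weak sub- and supersolutions. -/
def IsWeakSolution {N : ℕ} (p μ m : ℝ) (f : ℝ → ℝ)
    (u : EuclideanSpace ℝ (Fin N) → ℝ) : Prop :=
  IsWeakSubsolution p μ m f u ∧ IsWeakSupersolution p μ m f u

/-- An (almost everywhere defined) function is radial if it agrees almost everywhere with
a function of `|x|`. -/
def IsRadial {N : ℕ} (u : EuclideanSpace ℝ (Fin N) → ℝ) : Prop :=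
  ∃ g : ℝ → ℝ, ∀ᵐ x : EuclideanSpace ℝ (Fin N), u x = g ‖x‖

/-- `Γ_μ(γ) = γ^{p-1} [(p-1) γ - (N-p)] + μ`. -/
def Gam (N : ℕ) (p μ γ : ℝ) : ℝ :=
  γ ^ (p - 1) * ((p - 1) * γ - (N - p)) + μ

end HardyPLaplace

end

/-!
Away from the origin a radial solution `u = g(|x|)` solves an ordinary differential equation, and
its behaviour at the origin is that of a scalar Riccati equation.

*Reduction to an ordinary differential equation.* Testing the definition of the weak gradient with
`ζ(|x|) |x|^(-N) x` shows that `g` has a locally integrable weak derivative on `(0, ∞)`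
(`exists_profile_eq_primitive`), and integration by parts in polar coordinates identifies the weak
gradient as `g'(|x|) x / |x|` (`weakGradient_eq_radial`). Testing the equation with functions of
`|x|` then gives `-(r^(N-1) |g'|^(p-2) g')' = r^(N-1) ρ` with
`ρ = μ r^(-p) g^(p-1) - m g^(p-1) + f(g)`, so `g` and the flux are of class `C¹`
(`exists_radial_solution`). Test functions supported away from the origin suffice for all of this.
Since `|ρ| ≤ C g^(p-1)` locally, a zero of `g` would spread to an interval, so `g > 0` everywhere
(`pos_of_radial_solution`).

*The Riccati equation.* Put `z = -r g' / g` and `y = |z|^(p-2) z`. Then `r y' = F(y) + ε(r)` with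
`F(y) = μ - (N-p) y + (p-1) |y|^(p/(p-1))` and `ε = -m r^p + r^p f(g) / g^(p-1)`. For `γ ≥ 0`,
`F(γ^(p-1)) = Γ_μ(γ)`. The function `F` is convex, and it is negative at `((N-p)/p)^(p-1)`
because `μ` is below the Hardy constant. By the finiteness of the energy, `g = o(r^(-(N-p)/p))`
(`tendsto_mul_rpow_critical`), and the growth conditions on `f` turn this into `ε → 0`.

*The limit* (`exists_tendsto_of_riccati`). As `r → 0` the smaller zero `y₁ = γ₁^(p-1)` of `F` is
repelling. If `y` exceeded some level between `y₁` and `((N-p)/p)^(p-1)` at arbitrarily small radii,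
it would rise beyond `((N-p)/p)^(p-1)` for good and force `g` to grow at least like
`r^(-(N-p)/p)`, which is excluded (`riccati_eventually_lt`). If it became very negative
it would reach `-∞` at a positive radius (`riccati_eventually_ge`). So `z` stays below some exponent
smaller than `(N-p)/p`, hence `ε = O(r^δ)` for some `δ > 0`, and a bounded solution near a repelling
zero with such a perturbation satisfies `y - y₁ = O(r^δ)`. Therefore `z - γ₁` is integrable with
respect to `dr / r`, that is, `log g + γ₁ log r` converges.
-/

namespace HardyPLaplace

/-! ### Odd powers -/

/-- The odd extension `y ↦ |y|^(α-1) y` of the power function `y ↦ y ^ α`. Written as a difference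
of powers of nonnegative numbers, it is visibly continuous and monotone for every `α > 0`, also
when `α < 1` makes `|y|^(α-1)` singular. -/
noncomputable def spow (α y : ℝ) : ℝ := (max y 0) ^ α - (max (-y) 0) ^ α

theorem spow_of_nonneg {α y : ℝ} (hα : α ≠ 0) (hy : 0 ≤ y) : spow α y = y ^ α := by
  simp [spow, hy, Real.zero_rpow hα]

theorem spow_neg (α y : ℝ) : spow α (-y) = -spow α y := by
  simp [spow]

theorem spow_eq {α : ℝ} (hα : α ≠ 0) (y : ℝ) : spow α y = |y| ^ (α - 1) * y := by
  have key : ∀ z : ℝ, 0 ≤ z → spow α z = |z| ^ (α - 1) * z := by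
    intro z hz
    rw [spow_of_nonneg hα hz, abs_of_nonneg hz]
    rcases hz.eq_or_lt with rfl | hz
    · simp [Real.zero_rpow hα]
    · rw [Real.rpow_sub_one hz.ne', div_mul_cancel₀ _ hz.ne']
  rcases le_total 0 y with hy | hy
  · exact key y hy
  · have := key (-y) (by linarith)
    rw [spow_neg, abs_neg] at this
    linarith

theorem continuous_spow {α : ℝ} (hα : 0 < α) : Continuous (spow α) := by
  unfold spow
  exact ((continuous_id.max continuous_const).rpow_const (fun _ => Or.inr hα.le)).sub
    ((continuous_neg.max continuous_const).rpow_const (fun _ => Or.inr hα.le))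

theorem abs_spow {α : ℝ} (hα : α ≠ 0) (y : ℝ) : |spow α y| = |y| ^ α := by
  rcases le_total 0 y with hy | hy
  · rw [spow_of_nonneg hα hy, abs_of_nonneg hy, abs_of_nonneg (Real.rpow_nonneg hy _)]
  · have hy' : 0 ≤ -y := by linarith
    rw [← abs_neg, ← spow_neg, spow_of_nonneg hα hy', abs_of_nonpos hy,
      abs_of_nonneg (Real.rpow_nonneg hy' _)]

theorem spow_mono {α : ℝ} (hα : 0 < α) : Monotone (spow α) := by
  intro x y hxy
  unfold spow
  gcongr

theorem spow_mul_of_nonneg {α : ℝ} (hα : α ≠ 0) {a : ℝ} (ha : 0 ≤ a) (y : ℝ) :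
    spow α (a * y) = a ^ α * spow α y := by
  rcases le_total 0 y with hy | hy
  · rw [spow_of_nonneg hα (mul_nonneg ha hy), spow_of_nonneg hα hy, Real.mul_rpow ha hy]
  · have hy' : 0 ≤ -y := by linarith
    have : spow α (a * -y) = a ^ α * spow α (-y) := by
      rw [spow_of_nonneg hα (mul_nonneg ha hy'), spow_of_nonneg hα hy', Real.mul_rpow ha hy']
    rw [mul_neg, spow_neg, spow_neg] at this
    linarith

theorem spow_inv_spow {α : ℝ} (hα : α ≠ 0) (y : ℝ) : spow (1 / α) (spow α y) = y := by
  have key : ∀ z : ℝ, 0 ≤ z → spow (1 / α) (spow α z) = z := by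
    intro z hz
    rw [spow_of_nonneg hα hz, spow_of_nonneg (by positivity) (Real.rpow_nonneg hz _),
      ← Real.rpow_mul hz, mul_one_div_cancel hα, Real.rpow_one]
  rcases le_total 0 y with hy | hy
  · exact key y hy
  · have := key (-y) (by linarith)
    rw [spow_neg, spow_neg] at this
    linarith

theorem spow_spow_inv {α : ℝ} (hα : α ≠ 0) (y : ℝ) : spow α (spow (1 / α) y) = y := by
  have := spow_inv_spow (α := 1 / α) (by positivity) y
  rwa [one_div_one_div] at this

/-! ### Differential inequalities on a half-line -/

theorem monotoneOn_Ici_of_hasDerivAt {f f' : ℝ → ℝ} {a : ℝ}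
    (hf : ∀ s, a ≤ s → HasDerivAt f (f' s) s) (h0 : ∀ s, a ≤ s → 0 ≤ f' s) :
    MonotoneOn f (Set.Ici a) := by
  apply monotoneOn_of_deriv_nonneg (convex_Ici a)
  · exact fun s hs => (hf s hs).continuousAt.continuousWithinAt
  · intro s hs
    rw [interior_Ici] at hs
    exact (hf s (le_of_lt hs)).differentiableAt.differentiableWithinAt
  · intro s hs
    rw [interior_Ici] at hs
    rw [(hf s (le_of_lt hs)).deriv]
    exact h0 s (le_of_lt hs)

theorem add_mul_le_of_le_hasDerivAt {f f' : ℝ → ℝ} {a c : ℝ}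
    (hf : ∀ s, a ≤ s → HasDerivAt f (f' s) s) (h0 : ∀ s, a ≤ s → c ≤ f' s) {s : ℝ} (hs : a ≤ s) :
    f a + c * (s - a) ≤ f s := by
  have := monotoneOn_Ici_of_hasDerivAt (f := fun s => f s - c * s) (f' := fun s => f' s - c)
    (fun t ht => by simpa using (hf t ht).fun_sub ((hasDerivAt_id t).const_mul c))
    (fun t ht => by linarith [h0 t ht]) (Set.mem_Ici.2 le_rfl) (Set.mem_Ici.2 hs) hs
  simp only at this
  linarith

/-- A differentiable function which moves downwards faster than a barrier `B` whenever it meets it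
stays below `B`. -/
theorem le_barrier {f f' B B' : ℝ → ℝ} {a : ℝ}
    (hf : ∀ s, a ≤ s → HasDerivAt f (f' s) s) (hB : ∀ s, HasDerivAt B (B' s) s)
    (ha : f a ≤ B a) (h : ∀ s, a ≤ s → f s = B s → f' s < B' s) {s : ℝ} (hs : a ≤ s) :
    f s ≤ B s := by
  refine image_le_of_deriv_right_lt_deriv_boundary (a := a) (b := s) (f := f) (f' := f')
    (fun t ht => (hf t ht.1).continuousAt.continuousWithinAt)
    (fun t ht => (hf t ht.1).hasDerivWithinAt) ha hB (fun t ht => h t ht.1) ⟨hs, le_rfl⟩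

theorem barrier_le {f f' B B' : ℝ → ℝ} {a : ℝ}
    (hf : ∀ s, a ≤ s → HasDerivAt f (f' s) s) (hB : ∀ s, HasDerivAt B (B' s) s)
    (ha : B a ≤ f a) (h : ∀ s, a ≤ s → f s = B s → B' s < f' s) {s : ℝ} (hs : a ≤ s) :
    B s ≤ f s := by
  have := le_barrier (f := fun s => - f s) (B := fun s => - B s) (fun t ht => (hf t ht).fun_neg)
    (fun t => (hB t).fun_neg) (neg_le_neg ha)
    (fun t ht he => neg_lt_neg (h t ht (neg_injective he))) hs
  exact neg_le_neg_iff.1 this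

/-- A bounded function cannot grow at a positive rate forever. -/
theorem false_of_bounded_of_le_hasDerivAt {f f' : ℝ → ℝ} {a c R : ℝ} (hc : 0 < c)
    (hf : ∀ s, a ≤ s → HasDerivAt f (f' s) s) (h0 : ∀ s, a ≤ s → c ≤ f' s)
    (hR : ∀ s, a ≤ s → f s ≤ R) : False := by
  have h1 := hR a le_rfl
  have hs : a ≤ a + ((R - f a) / c + 1) := by
    have : 0 ≤ (R - f a) / c := div_nonneg (by linarith) hc.le
    linarith
  have h2 := add_mul_le_of_le_hasDerivAt hf h0 hs
  have h3 := hR _ hs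
  have : c * (a + ((R - f a) / c + 1) - a) = R - f a + c := by field_simp; ring
  linarith

/-- A bounded function which is repelled from zero at an exponential rate, up to an exponentially
small error, is itself exponentially small. -/
theorem le_exp_of_repelled {h d : ℝ → ℝ} {a c K δ R : ℝ} (hc : 0 < c) (hδ : 0 ≤ δ) (hK : 0 < K)
    (hd : ∀ s, a ≤ s → HasDerivAt h (d s) s)
    (hrep : ∀ s, a ≤ s → 0 ≤ h s → c * h s - K * Real.exp (-δ * s) ≤ d s)
    (hR : ∀ s, a ≤ s → h s ≤ R) {s : ℝ} (hs : a ≤ s) :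
    h s ≤ 2 * K / c * Real.exp (-δ * s) := by
  by_contra! hlt
  set M := 2 * K / c with hM
  have hMpos : 0 < M := by positivity
  have hcM : c * M = 2 * K := by rw [hM]; field_simp
  have hB : ∀ t : ℝ, HasDerivAt (fun t => M * Real.exp (-δ * t))
      (M * (Real.exp (-δ * t) * (-δ))) t := fun t => by
    have := ((hasDerivAt_id t).const_mul (-δ)).exp.const_mul M
    simpa using this
  have hbar : ∀ t, s ≤ t → M * Real.exp (-δ * t) ≤ h t := fun t ht => by
    refine barrier_le (B := fun t => M * Real.exp (-δ * t)) (fun t ht => hd t (hs.trans ht))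
      hB hlt.le ?_ ht
    intro t ht he
    have he' : 0 < Real.exp (-δ * t) := Real.exp_pos _
    have h1 := hrep t (hs.trans ht) (by rw [he]; positivity)
    have h2 : c * h t = 2 * K * Real.exp (-δ * t) := by rw [he, ← mul_assoc, hcM]
    have h3 : M * (Real.exp (-δ * t) * (-δ)) ≤ 0 := by
      have : 0 ≤ M * (Real.exp (-δ * t) * δ) := by positivity
      linarith
    nlinarith
  have hgrow : ∀ t, s ≤ t → c / 2 * h t ≤ d t := fun t ht => by
    have hb := hbar t ht
    have he' : 0 < Real.exp (-δ * t) := Real.exp_pos _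
    have h1 := hrep t (hs.trans ht) (le_trans (by positivity) hb)
    have h2 : c / 2 * (M * Real.exp (-δ * t)) = K * Real.exp (-δ * t) := by
      rw [← mul_assoc, div_mul_eq_mul_div, hcM]; ring
    have h3 := mul_le_mul_of_nonneg_left hb (by positivity : 0 ≤ c / 2)
    linarith
  have hpos : ∀ t, s ≤ t → 0 < h t := fun t ht => lt_of_lt_of_le (by positivity) (hbar t ht)
  have hmono := monotoneOn_Ici_of_hasDerivAt (fun t ht => hd t (hs.trans ht))
    (fun t ht => (mul_pos (by positivity) (hpos t ht)).le.trans (hgrow t ht))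
  refine false_of_bounded_of_le_hasDerivAt (a := s) (c := c / 2 * h s)
    (mul_pos (by positivity) (hpos s le_rfl)) (fun t ht => hd t (hs.trans ht)) (fun t ht => ?_)
    (fun t ht => hR t (hs.trans ht))
  exact (mul_le_mul_of_nonneg_left (hmono (Set.mem_Ici.2 le_rfl) (Set.mem_Ici.2 ht) ht)
    (by positivity)).trans (hgrow t ht)

/-- Adding or subtracting `K / δ * exp (-δ s)` makes `f` antitone or monotone. -/
theorem exists_tendsto_of_abs_hasDerivAt_le_exp {f d : ℝ → ℝ} {a K δ : ℝ} (hδ : 0 < δ)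
    (hd : ∀ s, a ≤ s → HasDerivAt f (d s) s)
    (hK : ∀ s, a ≤ s → |d s| ≤ K * Real.exp (-δ * s)) : ∃ l, Tendsto f atTop (𝓝 l) := by
  have hE : ∀ t : ℝ, HasDerivAt (fun t => K / δ * Real.exp (-δ * t))
      (-(K * Real.exp (-δ * t))) t := fun t => by
    have := ((hasDerivAt_id t).const_mul (-δ)).exp.const_mul (K / δ)
    refine this.congr_deriv ?_
    field_simp
    simp
  have hm1 : MonotoneOn (fun t => f t - K / δ * Real.exp (-δ * t)) (Set.Ici a) :=
    monotoneOn_Ici_of_hasDerivAt (fun t ht => (hd t ht).sub (hE t))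
      (fun t ht => by linarith [(abs_le.1 (hK t ht)).1])
  have hm2 : MonotoneOn (fun t => -(f t + K / δ * Real.exp (-δ * t))) (Set.Ici a) :=
    monotoneOn_Ici_of_hasDerivAt (fun t ht => ((hd t ht).add (hE t)).fun_neg)
      (fun t ht => by linarith [(abs_le.1 (hK t ht)).2])
  have hE0 : Tendsto (fun t => K / δ * Real.exp (-δ * t)) atTop (𝓝 0) := by
    have : Tendsto (fun t : ℝ => -δ * t) atTop atBot :=
      tendsto_id.const_mul_atTop_of_neg (by linarith)
    simpa using (Real.tendsto_exp_atBot.comp this).const_mul (K / δ)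
  have hKδ : 0 ≤ K / δ := by
    have := (abs_nonneg _).trans (hK a le_rfl)
    have := nonneg_of_mul_nonneg_left this (Real.exp_pos _)
    positivity
  set m : ℝ → ℝ := fun t => f (max a t) - K / δ * Real.exp (-δ * max a t) with hmdef
  have hmm : Monotone m := fun x y hxy =>
    hm1 (Set.mem_Ici.2 (le_max_left _ _)) (Set.mem_Ici.2 (le_max_left _ _)) (max_le_max le_rfl hxy)
  have hbdd : BddAbove (Set.range m) := by
    refine ⟨f a + K / δ * Real.exp (-δ * a), ?_⟩
    rintro _ ⟨t, rfl⟩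
    have := hm2 (Set.mem_Ici.2 (le_refl a)) (Set.mem_Ici.2 (le_max_left a t)) (le_max_left a t)
    have h2 : 0 ≤ K / δ * Real.exp (-δ * max a t) := by positivity
    beta_reduce at this
    change f (max a t) - K / δ * Real.exp (-δ * max a t) ≤ _
    linarith
  refine ⟨_, Tendsto.congr' ?_ ((tendsto_atTop_ciSup hmm hbdd).add hE0)⟩
  filter_upwards [eventually_ge_atTop a] with t ht
  simp [hmdef, max_eq_right ht]

/-! ### The autonomous Riccati equation -/

/-- The function `Γ_μ(γ) = γ^(p-1) ((p-1) γ - (n-p)) + μ`, expressed through `y = γ^(p-1)` and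
extended to negative `y`. In contrast to `Γ_μ` it is convex on the whole line. -/
noncomputable def riccati (n p μ y : ℝ) : ℝ := μ - (n - p) * y + (p - 1) * |y| ^ (p / (p - 1))

theorem convexOn_riccati {n p μ : ℝ} (hp : 1 < p) : ConvexOn ℝ Set.univ (riccati n p μ) := by
  have h1 : (1 : ℝ) ≤ p / (p - 1) := by rw [le_div_iff₀ (by linarith)]; linarith
  have himg : (fun y : ℝ => |y|) '' Set.univ ⊆ Set.Ici 0 := by
    rintro _ ⟨y, -, rfl⟩; exact abs_nonneg y
  have himg' : (fun y : ℝ => |y|) '' Set.univ = Set.Ici 0 := by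
    refine himg.antisymm fun y hy => ⟨y, trivial, abs_of_nonneg hy⟩
  have hpow : ConvexOn ℝ Set.univ (fun y : ℝ => |y| ^ (p / (p - 1))) := by
    refine ConvexOn.comp (g := fun z : ℝ => z ^ (p / (p - 1))) (f := fun y : ℝ => |y|) ?_ ?_ ?_
    · rw [himg']; exact convexOn_rpow h1
    · exact convexOn_univ_norm (E := ℝ)
    · rw [himg']
      intro x hx y hy hxy
      exact Real.rpow_le_rpow hx hxy (by linarith)
  have hlin : ConvexOn ℝ Set.univ (fun y : ℝ => μ - (n - p) * y) := by
    refine ⟨convex_univ, fun x _ y _ a b _ _ hab => le_of_eq ?_⟩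
    simp only [smul_eq_mul]
    linear_combination (-μ) * hab
  exact hlin.add (hpow.smul (by linarith : (0 : ℝ) ≤ p - 1))

theorem riccati_rpow {n p μ γ : ℝ} (hp : 1 < p) (hγ : 0 ≤ γ) :
    riccati n p μ (γ ^ (p - 1)) = γ ^ (p - 1) * ((p - 1) * γ - (n - p)) + μ := by
  have h0 : p - 1 ≠ 0 := by linarith
  have h1 : |γ ^ (p - 1)| ^ (p / (p - 1)) = γ ^ (p - 1) * γ := by
    rw [abs_of_nonneg (Real.rpow_nonneg hγ _), ← Real.rpow_mul hγ, mul_div_cancel₀ _ h0]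
    rcases hγ.eq_or_lt with rfl | h
    · rw [mul_zero, Real.zero_rpow (by linarith)]
    · rw [Real.rpow_sub_one h.ne', div_mul_cancel₀ _ h.ne']
  rw [riccati, h1]; ring

theorem riccati_critical {n p μ : ℝ} (hp : 1 < p) (hn : p < n) :
    riccati n p μ (((n - p) / p) ^ (p - 1)) = μ - ((n - p) / p) ^ p := by
  have ha : 0 < (n - p) / p := div_pos (by linarith) (by linarith)
  have h1 : (p - 1) * ((n - p) / p) - (n - p) = -((n - p) / p) := by
    have : p ≠ 0 := by linarith
    field_simp
    ring
  rw [riccati_rpow hp ha.le, h1, mul_neg, Real.rpow_sub_one ha.ne', div_mul_cancel₀ _ ha.ne']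
  ring

/-- To the left of a point `yc` where `riccati` is negative, the zero `y₁ < yc` is exponentially
repelling for the flow `y' = -riccati y`. Both inequalities compare slopes of secants of a convex
function. -/
theorem riccati_repelling {n p μ y₁ yc : ℝ} (hp : 1 < p) (h1 : riccati n p μ y₁ = 0)
    (hc : riccati n p μ yc < 0) (h1c : y₁ < yc) :
    ∃ c > 0, (∀ y ≤ y₁, c * (y₁ - y) ≤ riccati n p μ y) ∧
      ∀ y, y₁ ≤ y → y ≤ yc → riccati n p μ y ≤ -(c * (y - y₁)) := by
  have hconv := convexOn_riccati (n := n) (μ := μ) hp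
  have hpos : 0 < yc - y₁ := by linarith
  refine ⟨-riccati n p μ yc / (yc - y₁), div_pos (by linarith) hpos, ?_, ?_⟩
  · intro y hy
    rcases hy.eq_or_lt with rfl | hy
    · simp [h1]
    · have := hconv.slope_mono_adjacent (Set.mem_univ y) (Set.mem_univ yc) hy h1c
      rw [h1, zero_sub, sub_zero, div_le_iff₀ (by linarith)] at this
      rw [neg_div]
      linarith
  · intro y hy hy'
    rcases hy.eq_or_lt with rfl | hy
    · simp [h1]
    rcases hy'.eq_or_lt with rfl | hy'
    · rw [div_mul_cancel₀ _ hpos.ne']; linarith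
    · have := hconv.secant_mono_aux2 (Set.mem_univ y₁) (Set.mem_univ yc) hy hy'
      rw [h1, sub_zero, sub_zero, div_le_iff₀ (by linarith)] at this
      rw [neg_div]
      linarith

/-! ### The perturbed Riccati equation -/

/-- In the variable `s = -log r`, a solution eventually stays below some level `yh` strictly
between the smaller zero `y₁` and the critical level. Above `yh` the drift is bounded below by a
positive constant, so that the solution would rise to the critical level and remain above it; then
`L` would grow at least at the critical rate. -/
theorem riccati_eventually_lt {n p μ y₁ : ℝ} (hp : 1 < p) (hn : p < n)
    (hμ : μ < ((n - p) / p) ^ p) (h1 : riccati n p μ y₁ = 0) (h1c : y₁ < ((n - p) / p) ^ (p - 1))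
    {Y L ε : ℝ → ℝ} {s₀ : ℝ}
    (hY : ∀ s, s₀ ≤ s → HasDerivAt Y (-(riccati n p μ (Y s) + ε s)) s)
    (hL : ∀ s, s₀ ≤ s → HasDerivAt L (spow (1 / (p - 1)) (Y s)) s)
    (hε : Tendsto ε atTop (𝓝 0))
    (hLa : Tendsto (fun s => L s - (n - p) / p * s) atTop atBot) :
    ∃ yh, y₁ < yh ∧ yh < ((n - p) / p) ^ (p - 1) ∧ ∀ᶠ s in atTop, Y s < yh := by
  set a := (n - p) / p with ha
  have hapos : 0 < a := div_pos (by linarith) (by linarith)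
  set yc := a ^ (p - 1) with hyc
  have hp1 : 0 < p - 1 := by linarith
  obtain ⟨c, hc, -, hc2⟩ := riccati_repelling hp h1
    (by rw [hyc, ha, riccati_critical hp hn]; linarith : riccati n p μ yc < 0) h1c
  set yh := (y₁ + yc) / 2 with hyh
  refine ⟨yh, by linarith, by linarith, ?_⟩
  set η := c * (yh - y₁) / 2 with hη
  have hηpos : 0 < η := by
    have : 0 < yh - y₁ := by linarith
    positivity
  have hεη : ∀ᶠ s in atTop, |ε s| < η := by
    have := hε.abs
    rw [abs_zero] at this
    exact this.eventually (gt_mem_nhds hηpos)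
  obtain ⟨s₁, hs₁⟩ := eventually_atTop.1 (hεη.and (eventually_ge_atTop s₀))
  have hdrift : ∀ s, s₁ ≤ s → yh ≤ Y s → Y s ≤ yc → η ≤ -(riccati n p μ (Y s) + ε s) := by
    intro s hs h2 h3
    have h4 := hc2 (Y s) (by linarith) h3
    have h5 := (abs_lt.1 (hs₁ s hs).1).2
    have h6 : c * (yh - y₁) ≤ c * (Y s - y₁) := by gcongr
    linarith
  filter_upwards [eventually_ge_atTop s₁] with s₂ hs₂
  by_contra! hlt
  have hY2 : ∀ s, s₂ ≤ s → HasDerivAt Y (-(riccati n p μ (Y s) + ε s)) s :=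
    fun s hs => hY s (hs₁ s (hs₂.trans hs)).2
  have hge : ∀ s, s₂ ≤ s → yh ≤ Y s := fun s hs =>
    barrier_le (B := fun _ => yh) (B' := fun _ => 0) hY2 (fun _ => hasDerivAt_const _ _) hlt
      (fun t ht he => hηpos.trans_le (hdrift t (hs₂.trans ht) he.ge (by rw [he]; linarith))) hs
  obtain ⟨s₃, hs₃, hY3⟩ : ∃ s₃, s₂ ≤ s₃ ∧ yc ≤ Y s₃ := by
    by_contra! hcon
    exact false_of_bounded_of_le_hasDerivAt hηpos hY2
      (fun t ht => hdrift t (hs₂.trans ht) (hge t ht) (hcon t ht).le) (fun t ht => (hcon t ht).le)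
  have hge' : ∀ s, s₃ ≤ s → yc ≤ Y s := fun s hs =>
    barrier_le (B := fun _ => yc) (B' := fun _ => 0) (fun t ht => hY2 t (hs₃.trans ht))
      (fun _ => hasDerivAt_const _ _) hY3
      (fun t ht he => hηpos.trans_le
        (hdrift t (hs₂.trans (hs₃.trans ht)) (hge t (hs₃.trans ht)) he.le)) hs
  have hroot : spow (1 / (p - 1)) yc = a := by
    rw [hyc, ← spow_of_nonneg hp1.ne' hapos.le, spow_inv_spow hp1.ne']
  have hgrow : ∀ s, s₃ ≤ s → a ≤ spow (1 / (p - 1)) (Y s) := fun s hs => by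
    rw [← hroot]
    exact spow_mono (by positivity) (hge' s hs)
  obtain ⟨s, hs, hs'⟩ := ((hLa.eventually (eventually_lt_atBot (L s₃ - a * s₃))).and
    (eventually_ge_atTop s₃)).exists
  have := add_mul_le_of_le_hasDerivAt
    (fun t ht => hL t (hs₁ t (hs₂.trans (hs₃.trans ht))).2) hgrow hs'
  linarith

/-- A solution of the perturbed Riccati equation which exists for all times is bounded below,
since very negative solutions escape to `-∞` in finite time. -/
theorem riccati_eventually_ge {n p μ : ℝ} (hp : 1 < p) (hn : p < n) (hμ : 0 ≤ μ)
    {Y ε : ℝ → ℝ} {s₀ : ℝ}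
    (hY : ∀ s, s₀ ≤ s → HasDerivAt Y (-(riccati n p μ (Y s) + ε s)) s)
    (hε : Tendsto ε atTop (𝓝 0)) :
    ∃ R > 0, ∀ᶠ s in atTop, -R ≤ Y s := by
  have hp1 : 0 < p - 1 := by linarith
  have hp' : 1 ≤ p / (p - 1) := by rw [le_div_iff₀ hp1]; linarith
  set R := max 1 (2 / (p - 1)) with hR
  have hR1 : 1 ≤ R := le_max_left _ _
  refine ⟨R, by linarith, ?_⟩
  have hεη : ∀ᶠ s in atTop, |ε s| < 1 := by
    have := hε.abs
    rw [abs_zero] at this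
    exact this.eventually (gt_mem_nhds one_pos)
  obtain ⟨s₁, hs₁⟩ := eventually_atTop.1 (hεη.and (eventually_ge_atTop s₀))
  -- the superlinear term of `riccati` dominates the perturbation below `-R`
  have hdrift : ∀ s, s₁ ≤ s → Y s ≤ -R →
      (p - 1) / 2 * |Y s| ^ (p / (p - 1)) ≤ riccati n p μ (Y s) + ε s ∧
      0 < riccati n p μ (Y s) + ε s := by
    intro s hs h2
    have h3 : R ≤ |Y s| := by rw [abs_of_nonpos (by linarith)]; linarith
    have h4 : |Y s| ≤ |Y s| ^ (p / (p - 1)) := Real.self_le_rpow_of_one_le (hR1.trans h3) hp'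
    have h5 : 2 ≤ (p - 1) * |Y s| ^ (p / (p - 1)) := by
      have h6 : 2 / (p - 1) ≤ |Y s| ^ (p / (p - 1)) := (le_max_right _ _).trans (h3.trans h4)
      rw [div_le_iff₀ hp1] at h6
      linarith
    have h7 := (abs_lt.1 (hs₁ s hs).1).1
    have h8 : 0 ≤ (n - p) * (-Y s) := mul_nonneg (by linarith) (by linarith)
    unfold riccati
    constructor <;> nlinarith
  filter_upwards [eventually_ge_atTop s₁] with s₂ hs₂
  by_contra! hlt
  have hY2 : ∀ s, s₂ ≤ s → HasDerivAt Y (-(riccati n p μ (Y s) + ε s)) s :=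
    fun s hs => hY s (hs₁ s (hs₂.trans hs)).2
  have hle : ∀ s, s₂ ≤ s → Y s ≤ -R := fun s hs =>
    le_barrier (B := fun _ => -R) (B' := fun _ => 0) hY2 (fun _ => hasDerivAt_const _ _) hlt.le
      (fun t ht he => neg_lt_zero.2 (hdrift t (hs₂.trans ht) he.le).2) hs
  -- `V = |Y| ^ (-1/(p-1))` is positive but decreases at least at a constant rate
  set β := 1 / (p - 1) with hβ
  have hβpos : 0 < β := by positivity
  have hV : ∀ s, s₂ ≤ s → HasDerivAt (fun s => -(-Y s) ^ (-β))
      (-((riccati n p μ (Y s) + ε s) * (-β) * (-Y s) ^ (-β - 1))) s := fun s hs => by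
    have h1 := (hY2 s hs).fun_neg
    rw [neg_neg] at h1
    exact (h1.rpow_const (p := -β) (Or.inl (by linarith [hle s hs]))).fun_neg
  refine false_of_bounded_of_le_hasDerivAt (a := s₂) (c := 1 / 2) (R := 0) (by norm_num) hV ?_ ?_
  · intro s hs
    have h1 := hle s hs
    have hpos : 0 < -Y s := by linarith
    have h2 := (hdrift s (hs₂.trans hs) h1).1
    rw [abs_of_neg (by linarith : Y s < 0)] at h2
    have hexp : p / (p - 1) = β + 1 := by rw [hβ]; field_simp; ring
    have h3 : (-Y s) ^ (p / (p - 1)) * (-Y s) ^ (-β - 1) = 1 := by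
      rw [← Real.rpow_add hpos, hexp]; simp
    have h4 : 0 < (-Y s) ^ (-β - 1) := Real.rpow_pos_of_pos hpos _
    have h5 := mul_le_mul_of_nonneg_right h2 (mul_pos hβpos h4).le
    have h6 : (p - 1) / 2 * (-Y s) ^ (p / (p - 1)) * (β * (-Y s) ^ (-β - 1)) = 1 / 2 := by
      calc _ = (p - 1) * β / 2 * ((-Y s) ^ (p / (p - 1)) * (-Y s) ^ (-β - 1)) := by ring
        _ = 1 / 2 := by rw [h3, hβ]; field_simp
    linarith
  · intro s hs
    have : 0 < -Y s := by linarith [hle s hs]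
    linarith [Real.rpow_pos_of_pos this (-β)]

/-- Exponential convergence survives the signed power map. -/
theorem spow_sub_le_exp {α y₁ K δ : ℝ} (hα : 0 < α) (hy₁ : 0 ≤ y₁) (hδ : 0 < δ) {Y : ℝ → ℝ}
    (hY : ∀ᶠ s in atTop, |Y s - y₁| ≤ K * Real.exp (-δ * s)) :
    ∃ K' δ', 0 < δ' ∧ ∀ᶠ s in atTop, |spow α (Y s) - spow α y₁| ≤ K' * Real.exp (-δ' * s) := by
  rcases hy₁.eq_or_lt with rfl | hy₁
  · refine ⟨|K| ^ α, δ * α, by positivity, ?_⟩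
    filter_upwards [hY] with s hs
    rw [spow_of_nonneg hα.ne' le_rfl, Real.zero_rpow hα.ne', sub_zero, abs_spow hα.ne']
    rw [sub_zero] at hs
    have h1 : |Y s| ≤ |K| * Real.exp (-δ * s) :=
      hs.trans (mul_le_mul_of_nonneg_right (le_abs_self K) (Real.exp_pos _).le)
    calc |Y s| ^ α ≤ (|K| * Real.exp (-δ * s)) ^ α := by gcongr
      _ = |K| ^ α * Real.exp (-(δ * α) * s) := by
        rw [Real.mul_rpow (abs_nonneg _) (Real.exp_pos _).le, ← Real.exp_mul]; ring_nf
  · have hlim : Tendsto Y atTop (𝓝 y₁) := by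
      have h0 : Tendsto (fun t => K * Real.exp (-δ * t)) atTop (𝓝 0) := by
        have : Tendsto (fun t : ℝ => -δ * t) atTop atBot :=
          tendsto_id.const_mul_atTop_of_neg (by linarith)
        simpa using (Real.tendsto_exp_atBot.comp this).const_mul K
      rw [tendsto_iff_norm_sub_tendsto_zero]
      exact squeeze_zero' (Eventually.of_forall fun _ => norm_nonneg _) hY h0
    have hder : DifferentiableAt ℝ (spow α) y₁ := by
      have h1 : (fun y : ℝ => y ^ α) =ᶠ[𝓝 y₁] spow α := by
        filter_upwards [lt_mem_nhds hy₁] with y hy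
        rw [spow_of_nonneg hα.ne' hy.le]
      exact (Real.differentiableAt_rpow_const_of_ne α hy₁.ne').congr_of_eventuallyEq h1.symm
    obtain ⟨C, hC⟩ := (hder.isBigO_sub.comp_tendsto hlim).bound
    refine ⟨|C| * K, δ, hδ, ?_⟩
    filter_upwards [hC, hY] with s h1 h2
    simp only [Function.comp_apply, Real.norm_eq_abs] at h1
    calc _ ≤ C * |Y s - y₁| := h1
      _ ≤ |C| * |Y s - y₁| := mul_le_mul_of_nonneg_right (le_abs_self C) (abs_nonneg _)
      _ ≤ |C| * (K * Real.exp (-δ * s)) := by gcongr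
      _ = _ := by ring

/-- Here `s = -log r`, `L = log g`, and `Y` is the signed `(p-1)`-st power of the slope `L'`. Since
`L` grows at less than the critical rate `(n-p)/p`, its slope converges exponentially to the smaller
root `γ` of the characteristic equation. -/
theorem exists_tendsto_of_riccati {n p μ γ κ K : ℝ} (hp : 1 < p) (hn : p < n) (hμ0 : 0 ≤ μ)
    (hμ : μ < ((n - p) / p) ^ p) (hγ0 : 0 ≤ γ) (hγ : γ < (n - p) / p)
    (hroot : γ ^ (p - 1) * ((p - 1) * γ - (n - p)) + μ = 0) (hκ : 0 < κ)
    {Y L ε : ℝ → ℝ} {s₀ : ℝ}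
    (hY : ∀ s, s₀ ≤ s → HasDerivAt Y (-(riccati n p μ (Y s) + ε s)) s)
    (hL : ∀ s, s₀ ≤ s → HasDerivAt L (spow (1 / (p - 1)) (Y s)) s)
    (hε : ∀ s, s₀ ≤ s →
      |ε s| ≤ K * (Real.exp (-p * s) + Real.exp (κ * (L s - (n - p) / p * s))))
    (hLa : Tendsto (fun s => L s - (n - p) / p * s) atTop atBot) :
    ∃ l, Tendsto (fun s => L s - γ * s) atTop (𝓝 l) := by
  have hp1 : 0 < p - 1 := by linarith
  have hapos : 0 < (n - p) / p := div_pos (by linarith) (by linarith)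
  have hexp : ∀ δ : ℝ, 0 < δ → Tendsto (fun t => Real.exp (-δ * t)) atTop (𝓝 0) := fun δ hδ => by
    have : Tendsto (fun t : ℝ => -δ * t) atTop atBot :=
      tendsto_id.const_mul_atTop_of_neg (by linarith)
    exact Real.tendsto_exp_atBot.comp this
  have hε0 : Tendsto ε atTop (𝓝 0) := by
    have h1 : Tendsto (fun s => K * (Real.exp (-p * s) +
        Real.exp (κ * (L s - (n - p) / p * s)))) atTop (𝓝 0) := by
      have := ((hexp p (by linarith)).add
        (Real.tendsto_exp_atBot.comp (hLa.const_mul_atBot hκ))).const_mul K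
      simpa using this
    refine squeeze_zero_norm' ?_ h1
    filter_upwards [eventually_ge_atTop s₀] with s hs using hε s hs
  set y₁ := γ ^ (p - 1) with hy₁
  have hy₁0 : 0 ≤ y₁ := Real.rpow_nonneg hγ0 _
  have h1 : riccati n p μ y₁ = 0 := by rw [hy₁, riccati_rpow hp hγ0, hroot]
  have h1c : y₁ < ((n - p) / p) ^ (p - 1) := Real.rpow_lt_rpow hγ0 hγ hp1
  obtain ⟨yh, hyh1, hyhc, hYh⟩ := riccati_eventually_lt hp hn hμ h1 h1c hY hL hε0 hLa
  obtain ⟨R, hR, hYR⟩ := riccati_eventually_ge hp hn hμ0 hY hε0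
  obtain ⟨s₁, hs₁⟩ := eventually_atTop.1
    ((hYh.and hYR).and ((eventually_ge_atTop s₀).and (eventually_ge_atTop 0)))
  -- the perturbation is exponentially small
  set zh := yh ^ (1 / (p - 1)) with hzh
  have hyh0 : 0 ≤ yh := hy₁0.trans hyh1.le
  have hzha : zh < (n - p) / p := by
    have := Real.rpow_lt_rpow hyh0 hyhc (by positivity : 0 < 1 / (p - 1))
    rwa [← Real.rpow_mul hapos.le, mul_one_div_cancel hp1.ne', Real.rpow_one] at this
  have hLle : ∀ s, s₁ ≤ s → L s ≤ L s₁ + zh * (s - s₁) := fun s hs => by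
    have := add_mul_le_of_le_hasDerivAt (f := fun s => - L s) (c := -zh)
      (fun t ht => (hL t (hs₁ t ht).2.1).fun_neg) (fun t ht => neg_le_neg ?_) hs
    · linarith
    · rw [hzh, ← spow_of_nonneg (by positivity) hyh0]
      exact spow_mono (by positivity) (hs₁ t ht).1.1.le
  set δ := min p (κ * ((n - p) / p - zh)) with hδ
  have hδpos : 0 < δ := lt_min (by linarith) (mul_pos hκ (by linarith))
  set K' := |K| * (1 + Real.exp (κ * (L s₁ - zh * s₁))) + 1 with hK'
  have hK'pos : 0 < K' := by positivity
  have hεδ : ∀ s, s₁ ≤ s → |ε s| ≤ K' * Real.exp (-δ * s) := fun s hs => by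
    have hs0 : 0 ≤ s := (hs₁ s hs).2.2
    have e1 : Real.exp (-p * s) ≤ Real.exp (-δ * s) := by
      have : δ * s ≤ p * s := mul_le_mul_of_nonneg_right (min_le_left _ _) hs0
      exact Real.exp_le_exp.2 (by linarith)
    have e2 : Real.exp (κ * (L s - (n - p) / p * s)) ≤
        Real.exp (κ * (L s₁ - zh * s₁)) * Real.exp (-δ * s) := by
      rw [← Real.exp_add]
      have h2 : δ * s ≤ κ * ((n - p) / p - zh) * s :=
        mul_le_mul_of_nonneg_right (min_le_right _ _) hs0
      have h3 := mul_le_mul_of_nonneg_left (hLle s hs) hκ.le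
      exact Real.exp_le_exp.2 (by linarith)
    calc |ε s| ≤ |K| * (Real.exp (-p * s) + Real.exp (κ * (L s - (n - p) / p * s))) :=
          (hε s (hs₁ s hs).2.1).trans (by gcongr; exact le_abs_self K)
      _ ≤ |K| * (Real.exp (-δ * s) + Real.exp (κ * (L s₁ - zh * s₁)) * Real.exp (-δ * s)) := by
          gcongr
      _ ≤ K' * Real.exp (-δ * s) := by
          have := Real.exp_pos (-δ * s)
          rw [hK']; nlinarith
  -- hence `Y` converges exponentially to the repelling zero
  obtain ⟨c, hc, hcl, hcr⟩ := riccati_repelling hp h1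
    (by rw [riccati_critical hp hn]; linarith) h1c
  have hup : ∀ s, s₁ ≤ s → Y s - y₁ ≤ 2 * K' / c * Real.exp (-δ * s) := fun s hs => by
    refine le_exp_of_repelled (h := fun s => Y s - y₁) (R := yh - y₁) hc hδpos.le hK'pos
      (fun t ht => (hY t (hs₁ t ht).2.1).sub_const y₁) ?_ ?_ hs
    · intro t ht h0
      have h2 := hcr (Y t) (by linarith) ((hs₁ t ht).1.1.le.trans hyhc.le)
      have h3 := (abs_le.1 (hεδ t ht)).2
      linarith
    · intro t ht
      linarith [(hs₁ t ht).1.1]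
  have hdown : ∀ s, s₁ ≤ s → y₁ - Y s ≤ 2 * K' / c * Real.exp (-δ * s) := fun s hs => by
    refine le_exp_of_repelled (h := fun s => y₁ - Y s) (R := y₁ + R) hc hδpos.le hK'pos
      (fun t ht => (hY t (hs₁ t ht).2.1).const_sub y₁) ?_ ?_ hs
    · intro t ht h0
      have h2 := hcl (Y t) (by linarith)
      have h3 := (abs_le.1 (hεδ t ht)).1
      linarith
    · intro t ht
      linarith [(hs₁ t ht).1.2]
  have hYexp : ∀ᶠ s in atTop, |Y s - y₁| ≤ 2 * K' / c * Real.exp (-δ * s) := by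
    filter_upwards [eventually_ge_atTop s₁] with s hs
    exact abs_le.2 ⟨by linarith [hdown s hs], hup s hs⟩
  obtain ⟨K₂, δ₂, hδ₂, hz⟩ := spow_sub_le_exp (α := 1 / (p - 1)) (by positivity) hy₁0 hδpos hYexp
  obtain ⟨s₂, hs₂⟩ := eventually_atTop.1 (hz.and (eventually_ge_atTop s₀))
  have hγs : spow (1 / (p - 1)) y₁ = γ := by
    rw [hy₁, ← spow_of_nonneg hp1.ne' hγ0, spow_inv_spow hp1.ne']
  rw [hγs] at hs₂
  refine exists_tendsto_of_abs_hasDerivAt_le_exp (a := s₂) hδ₂ (fun s hs => ?_)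
    (fun s hs => (hs₂ s hs).1)
  simpa using (hL s (hs₂ s hs).2).fun_sub ((hasDerivAt_id s).const_mul γ)

/-! ### From the radial equation to the Riccati equation -/

/-- A weighted Young inequality. Integrated over `s` and optimized in `lam`, it bounds `∫ |d|` by
the energy `∫ s^(n-1) |d|^p` as Hölder's inequality would. -/
theorem abs_le_young_weight {n p lam s d : ℝ} (hp : 1 < p) (hlam : 0 < lam) (hs : 0 < s) :
    |d| ≤ lam ^ p * (s ^ (n - 1) * |d| ^ p) +
      lam ^ (-(p / (p - 1))) * s ^ (-((n - 1) / (p - 1))) := by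
  have hpq : p.HolderConjugate (p / (p - 1)) := Real.HolderConjugate.conjExponent hp
  have hp0 : 0 < p := by linarith
  have hp1 : 0 < p - 1 := by linarith
  have hsw : 0 < s ^ ((n - 1) / p) := Real.rpow_pos_of_pos hs _
  have hy := Real.young_inequality_of_nonneg (a := lam * s ^ ((n - 1) / p) * |d|)
    (b := (lam * s ^ ((n - 1) / p))⁻¹) (by positivity) (by positivity) hpq
  have e0 : lam * s ^ ((n - 1) / p) * |d| * (lam * s ^ ((n - 1) / p))⁻¹ = |d| := by
    field_simp
  have e1 : (lam * s ^ ((n - 1) / p) * |d|) ^ p = lam ^ p * (s ^ (n - 1) * |d| ^ p) := by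
    rw [Real.mul_rpow (by positivity) (abs_nonneg _), Real.mul_rpow hlam.le hsw.le,
      ← Real.rpow_mul hs.le, div_mul_cancel₀ _ hp0.ne', mul_assoc]
  have e2 : ((lam * s ^ ((n - 1) / p))⁻¹) ^ (p / (p - 1)) =
      lam ^ (-(p / (p - 1))) * s ^ (-((n - 1) / (p - 1))) := by
    rw [Real.inv_rpow (by positivity), ← Real.rpow_neg (by positivity),
      Real.mul_rpow hlam.le hsw.le, ← Real.rpow_mul hs.le]
    congr 2
    field_simp
  rw [e0, e1, e2] at hy
  have h1 : lam ^ p * (s ^ (n - 1) * |d| ^ p) / p ≤ lam ^ p * (s ^ (n - 1) * |d| ^ p) :=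
    div_le_self (by positivity) hp.le
  have h2 : lam ^ (-(p / (p - 1))) * s ^ (-((n - 1) / (p - 1))) / (p / (p - 1)) ≤
      lam ^ (-(p / (p - 1))) * s ^ (-((n - 1) / (p - 1))) := by
    refine div_le_self (by positivity) ?_
    rw [le_div_iff₀ hp1]; linarith
  linarith

/-- A radial function with finite Dirichlet energy near the origin is
`o(r ^ (-(n-p)/p))`. -/
theorem tendsto_mul_rpow_critical {n p : ℝ} (hp : 1 < p) (hn : p < n) {g d : ℝ → ℝ}
    (hg : ∀ r, 0 < r → HasDerivAt g (d r) r) (hd : ContinuousOn d (Set.Ioi 0))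
    (hg0 : ∀ r, 0 < r → 0 ≤ g r)
    (hint : IntegrableOn (fun r => r ^ (n - 1) * |d r| ^ p) (Set.Ioc 0 1)) :
    Tendsto (fun r => g r * r ^ ((n - p) / p)) (𝓝[>] 0) (𝓝 0) := by
  have hp0 : 0 < p := by linarith
  have hp1 : 0 < p - 1 := by linarith
  set a := (n - p) / p with ha
  have hapos : 0 < a := div_pos (by linarith) hp0
  set b := (n - p) / (p - 1) with hb
  have hbpos : 0 < b := div_pos (by linarith) hp1
  set E : ℝ → ℝ := fun R => ∫ s in Set.Ioc 0 R, s ^ (n - 1) * |d s| ^ p with hE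
  have hE0 : Tendsto E (𝓝[>] 0) (𝓝 0) := by
    have h1 := intervalIntegral.continuousOn_primitive (μ := volume)
      ((integrableOn_Icc_iff_integrableOn_Ioc).2 hint)
    have h2 := h1 0 ⟨le_rfl, zero_le_one⟩
    rw [ContinuousWithinAt] at h2
    simp only [Set.Ioc_self, Measure.restrict_empty, integral_zero_measure] at h2
    refine h2.mono_left (nhdsWithin_le_of_mem ?_)
    exact mem_of_superset (Ioc_mem_nhdsGT one_pos) Set.Ioc_subset_Icc_self
  have key : ∀ M > 0, ∀ r R, 0 < r → r ≤ R → R ≤ 1 →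
      g r * r ^ a ≤ g R * r ^ a + M * E R + M ^ (-(1 / (p - 1))) / b := by
    intro M hM r R hr hrR hR
    -- this weight makes both terms of Young's inequality scale like `r ^ (-a)`
    set lam := (M * r ^ (-a)) ^ (1 / p) with hlam
    have hra : 0 < r ^ a := Real.rpow_pos_of_pos hr _
    have hMr : 0 < M * r ^ (-a) := mul_pos hM (Real.rpow_pos_of_pos hr _)
    have hlampos : 0 < lam := Real.rpow_pos_of_pos hMr _
    have hlam1 : lam ^ p = M * r ^ (-a) := by
      rw [hlam, ← Real.rpow_mul hMr.le, one_div_mul_cancel hp0.ne', Real.rpow_one]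
    have hlam2 : lam ^ (-(p / (p - 1))) = M ^ (-(1 / (p - 1))) * r ^ (a / (p - 1)) := by
      rw [hlam, ← Real.rpow_mul hMr.le,
        show 1 / p * -(p / (p - 1)) = -(1 / (p - 1)) by field_simp,
        Real.mul_rpow hM.le (Real.rpow_pos_of_pos hr _).le, ← Real.rpow_mul hr.le]
      congr 2
      field_simp
    have hsub : Set.uIcc r R ⊆ Set.Ioi 0 := by
      rw [Set.uIcc_of_le hrR]; exact fun s hs => hr.trans_le hs.1
    have hdint : IntervalIntegrable d volume r R :=
      (hd.mono hsub).intervalIntegrable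
    have hcw : ContinuousOn (fun s => s ^ (n - 1) * |d s| ^ p) (Set.uIcc r R) := by
      refine ContinuousOn.mul ?_ ?_
      · exact continuousOn_id.rpow_const fun s hs => Or.inl (ne_of_gt (hsub hs))
      · exact ((hd.mono hsub).abs).rpow_const fun s hs => Or.inr hp0.le
    have hce : ContinuousOn (fun s : ℝ => s ^ (-((n - 1) / (p - 1)))) (Set.uIcc r R) :=
      continuousOn_id.rpow_const fun s hs => Or.inl (ne_of_gt (hsub hs))
    have h1 : g r - g R = ∫ s in r..R, -d s := by
      rw [intervalIntegral.integral_neg, intervalIntegral.integral_eq_sub_of_hasDerivAt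
        (fun s hs => hg s (hsub hs)) hdint]
      ring
    have h2 : ∫ s in r..R, -d s ≤ ∫ s in r..R, (lam ^ p * (s ^ (n - 1) * |d s| ^ p) +
        lam ^ (-(p / (p - 1))) * s ^ (-((n - 1) / (p - 1)))) := by
      refine intervalIntegral.integral_mono_on hrR hdint.neg ?_ ?_
      · exact ((continuousOn_const.mul hcw).add (continuousOn_const.mul hce)).intervalIntegrable
      · intro s hs
        exact (neg_le_abs _).trans (abs_le_young_weight hp hlampos (hr.trans_le hs.1))
    have h3 : ∫ s in r..R, (lam ^ p * (s ^ (n - 1) * |d s| ^ p) +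
        lam ^ (-(p / (p - 1))) * s ^ (-((n - 1) / (p - 1)))) =
        lam ^ p * (∫ s in r..R, s ^ (n - 1) * |d s| ^ p) +
        lam ^ (-(p / (p - 1))) * ∫ s in r..R, s ^ (-((n - 1) / (p - 1))) := by
      rw [intervalIntegral.integral_add, intervalIntegral.integral_const_mul,
        intervalIntegral.integral_const_mul]
      · exact (continuousOn_const.mul hcw).intervalIntegrable
      · exact (continuousOn_const.mul hce).intervalIntegrable
    have h4 : ∫ s in r..R, s ^ (n - 1) * |d s| ^ p ≤ E R := by
      rw [intervalIntegral.integral_of_le hrR]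
      refine setIntegral_mono_set (hint.mono_set (Set.Ioc_subset_Ioc_right hR)) ?_
        (Set.Ioc_subset_Ioc_left hr.le).eventuallyLE
      filter_upwards [ae_restrict_mem measurableSet_Ioc] with s hs
      have := hs.1
      positivity
    have h5 : ∫ s in r..R, s ^ (-((n - 1) / (p - 1))) ≤ r ^ (-b) / b := by
      have he : -((n - 1) / (p - 1)) + 1 = -b := by rw [hb]; field_simp; ring
      rw [integral_rpow (Or.inr ⟨by
          intro h
          rw [h] at he
          linarith, fun h => lt_irrefl (0 : ℝ) (hsub h)⟩), he, div_neg, ← neg_div]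
      have := Real.rpow_pos_of_pos (hr.trans_le hrR) (-b)
      gcongr
      linarith
    have h6 : r ^ a * (lam ^ p * E R + lam ^ (-(p / (p - 1))) * (r ^ (-b) / b)) =
        M * E R + M ^ (-(1 / (p - 1))) / b := by
      have e1 : r ^ a * r ^ (-a) = 1 := by rw [← Real.rpow_add hr]; simp
      have e2 : r ^ a * (r ^ (a / (p - 1)) * r ^ (-b)) = 1 := by
        rw [← Real.rpow_add hr, ← Real.rpow_add hr]
        rw [show a + (a / (p - 1) + -b) = 0 by rw [ha, hb]; field_simp; ring, Real.rpow_zero]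
      rw [hlam1, hlam2]
      linear_combination M * E R * e1 + M ^ (-(1 / (p - 1))) / b * e2
    have h7 : g r ≤ g R + (lam ^ p * E R + lam ^ (-(p / (p - 1))) * (r ^ (-b) / b)) := by
      have t1 := mul_le_mul_of_nonneg_left h4 (Real.rpow_pos_of_pos hlampos p).le
      have t2 := mul_le_mul_of_nonneg_left h5
        (Real.rpow_pos_of_pos hlampos (-(p / (p - 1)))).le
      linarith
    have h8 := mul_le_mul_of_nonneg_right h7 hra.le
    linarith
  rw [Metric.tendsto_nhds]
  intro ε hε
  obtain ⟨M, hM0, hM⟩ : ∃ M > 0, M ^ (-(1 / (p - 1))) / b < ε / 3 := by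
    have h1 : Tendsto (fun M : ℝ => M ^ (-(1 / (p - 1))) / b) atTop (𝓝 0) := by
      simpa using (tendsto_rpow_neg_atTop (by positivity : 0 < 1 / (p - 1))).div_const b
    obtain ⟨M, h2, h3⟩ := ((h1.eventually (gt_mem_nhds (by positivity : 0 < ε / 3))).and
      (eventually_gt_atTop 0)).exists
    exact ⟨M, h3, h2⟩
  obtain ⟨R, hRE, hR0, hR1⟩ : ∃ R, M * E R < ε / 3 ∧ 0 < R ∧ R ≤ 1 := by
    have h1 : Tendsto (fun R => M * E R) (𝓝[>] 0) (𝓝 0) := by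
      simpa using hE0.const_mul M
    exact ((h1.eventually (gt_mem_nhds (by positivity : 0 < ε / 3))).and
      (Ioc_mem_nhdsGT one_pos)).exists
  have h1 : Tendsto (fun r : ℝ => g R * r ^ a) (𝓝[>] 0) (𝓝 0) := by
    have : Tendsto (fun r : ℝ => r ^ a) (𝓝[>] 0) (𝓝 0) := by
      have := (Real.continuousAt_rpow_const 0 a (Or.inr hapos.le)).tendsto
      rw [Real.zero_rpow hapos.ne'] at this
      exact this.mono_left nhdsWithin_le_nhds
    simpa using this.const_mul (g R)
  filter_upwards [h1.eventually (gt_mem_nhds (by positivity : 0 < ε / 3)),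
    Ioc_mem_nhdsGT hR0] with r hr hr'
  have h2 := key M hM0 r R hr'.1 hr'.2 hR1
  have h3 : 0 ≤ g r * r ^ a := mul_nonneg (hg0 r hr'.1) (Real.rpow_pos_of_pos hr'.1 _).le
  rw [Real.dist_0_eq_abs, abs_of_nonneg h3]
  linarith

/-- The Riccati equation for `y = |z|^(p-2) z`, where `z = - r g'(r) / g(r)` is the logarithmic
slope; here `W = r^(n-1) |g'|^(p-2) g'` is the flux. -/
theorem hasDerivAt_riccati_variable {n p μ : ℝ} (hp : 1 < p) {g d W : ℝ → ℝ} {r ρ : ℝ}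
    (hr : 0 < r) (hgr : 0 < g r) (hg : HasDerivAt g (d r) r)
    (hWr : W r = r ^ (n - 1) * spow (p - 1) (d r))
    (hW : HasDerivAt W (-(r ^ (n - 1) * ρ)) r) :
    -(r ^ (p - n) * W r * g r ^ (-(p - 1))) = spow (p - 1) (-(r * d r / g r)) ∧
    ∃ y', HasDerivAt (fun r => -(r ^ (p - n) * W r * g r ^ (-(p - 1)))) y' r ∧
      r * y' = riccati n p μ (spow (p - 1) (-(r * d r / g r))) +
        (r ^ p * ρ * g r ^ (-(p - 1)) - μ) := by
  have hp1 : 0 < p - 1 := by linarith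
  have hz : spow (p - 1) (-(r * d r / g r)) = -(r ^ (p - n) * W r * g r ^ (-(p - 1))) := by
    rw [spow_neg, show r * d r / g r = r / g r * d r by ring,
      spow_mul_of_nonneg hp1.ne' (by positivity), hWr, Real.div_rpow hr.le hgr.le,
      Real.rpow_neg hgr.le]
    have : r ^ (p - n) * r ^ (n - 1) = r ^ (p - 1) := by
      rw [← Real.rpow_add hr]; congr 1; ring
    rw [← this]
    ring
  refine ⟨hz.symm, _, ((((hasDerivAt_id r).rpow_const (p := p - n) (Or.inl hr.ne')).fun_mul
    hW).fun_mul (hg.rpow_const (p := -(p - 1)) (Or.inl hgr.ne'))).fun_neg, ?_⟩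
  have hpow : |spow (p - 1) (-(r * d r / g r))| ^ (p / (p - 1)) =
      r ^ (p - n + 1) * W r * d r * g r ^ (-p) := by
    rw [abs_spow hp1.ne', ← Real.rpow_mul (abs_nonneg _), mul_div_cancel₀ _ hp1.ne', abs_neg,
      abs_div, abs_mul, abs_of_pos hr, abs_of_pos hgr, Real.div_rpow (by positivity) hgr.le,
      Real.mul_rpow hr.le (abs_nonneg _), Real.rpow_neg hgr.le, hWr]
    have h1 : r ^ (p - n + 1) * r ^ (n - 1) = r ^ p := by
      rw [← Real.rpow_add hr]; congr 1; ring
    have h2 : spow (p - 1) (d r) * d r = |d r| ^ p := by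
      rcases eq_or_ne (d r) 0 with h | h
      · rw [h, mul_zero, abs_zero, Real.zero_rpow (by linarith)]
      · rw [spow_eq hp1.ne', mul_assoc, ← abs_mul_abs_self (d r), ← mul_assoc,
          ← Real.rpow_add_one (abs_pos.2 h).ne', ← Real.rpow_add_one (abs_pos.2 h).ne']
        congr 1; ring
    rw [← h1, ← h2]; ring
  rw [riccati, hpow, hz]
  have e1 : r * r ^ (p - n - 1) = r ^ (p - n) := by
    rw [mul_comm, ← Real.rpow_add_one hr.ne']; congr 1; ring
  have e2 : r * r ^ (p - n) = r ^ (p - n + 1) := by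
    rw [mul_comm, ← Real.rpow_add_one hr.ne']
  have e3 : r ^ (p - n + 1) * r ^ (n - 1) = r ^ p := by
    rw [← Real.rpow_add hr]; congr 1; ring
  have e4 : g r ^ (-(p - 1) - 1) = g r ^ (-p) := by congr 1; ring
  simp only [id]
  rw [e4, ← e3, ← e2, ← e1]
  ring

/-- The asymptotic behaviour at the origin of positive solutions of the radial equation, obtained
by passing to the variable `s = -log r` in the Riccati equation. -/
theorem radial_asymptotics {n p μ m γ C₀ : ℝ} (hp : 1 < p) (hn : p < n) (hμ0 : 0 ≤ μ)
    (hμ : μ < ((n - p) / p) ^ p) (hγ0 : 0 ≤ γ) (hγ : γ < (n - p) / p)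
    (hroot : γ ^ (p - 1) * ((p - 1) * γ - (n - p)) + μ = 0) {f : ℝ → ℝ}
    (hf : ∀ t, 0 < t → |f t| ≤ C₀ * (t ^ (p - 1) + t ^ (n * p / (n - p) - 1)))
    {g d W : ℝ → ℝ} (hg0 : ∀ r, 0 < r → 0 < g r)
    (hg : ∀ r, 0 < r → HasDerivAt g (d r) r) (hd : ContinuousOn d (Set.Ioi 0))
    (hWd : ∀ r, 0 < r → W r = r ^ (n - 1) * spow (p - 1) (d r))
    (hW : ∀ r, 0 < r → HasDerivAt W
      (-(r ^ (n - 1) * (μ / r ^ p * g r ^ (p - 1) - m * g r ^ (p - 1) + f (g r)))) r)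
    (hint : IntegrableOn (fun r => r ^ (n - 1) * |d r| ^ p) (Set.Ioc 0 1)) :
    ∃ C, 0 < C ∧ Tendsto (fun r => g r * r ^ γ) (𝓝[>] 0) (𝓝 C) := by
  have hp0 : 0 < p := by linarith
  have hp1 : 0 < p - 1 := by linarith
  set a := (n - p) / p with ha
  have hapos : 0 < a := div_pos (by linarith) hp0
  set κ := n * p / (n - p) - p with hκ
  have hnp : 0 < n - p := by linarith
  have hκa : a * κ = p := by rw [ha, hκ]; field_simp; ring
  have hκpos : 0 < κ := by
    have : 0 < a * κ := by rw [hκa]; exact hp0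
    exact pos_of_mul_pos_right this hapos.le
  set ρ : ℝ → ℝ := fun r => μ / r ^ p * g r ^ (p - 1) - m * g r ^ (p - 1) + f (g r) with hρ
  set ε : ℝ → ℝ := fun s =>
    Real.exp (-s) ^ p * ρ (Real.exp (-s)) * g (Real.exp (-s)) ^ (-(p - 1)) - μ with hε
  set L : ℝ → ℝ := fun s => Real.log (g (Real.exp (-s))) with hL
  set Y : ℝ → ℝ := fun s => -(Real.exp (-s) ^ (p - n) * W (Real.exp (-s)) *
    g (Real.exp (-s)) ^ (-(p - 1))) with hY
  have hexp : ∀ s : ℝ, HasDerivAt (fun s => Real.exp (-s)) (-Real.exp (-s)) s := fun s => by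
    simpa using (hasDerivAt_id s).neg.exp
  have hYeq : ∀ s, Y s =
      spow (p - 1) (-(Real.exp (-s) * d (Real.exp (-s)) / g (Real.exp (-s)))) := fun s =>
    have hr := Real.exp_pos (-s)
    (hasDerivAt_riccati_variable (μ := μ) hp hr (hg0 _ hr) (hg _ hr) (hWd _ hr) (hW _ hr)).1
  -- with `a κ = p`, the critical nonlinearity contributes `r^p g^κ = (r^a g)^κ` to `ε`
  have hLlog : ∀ s, Real.exp (κ * (L s - a * s)) = Real.exp (-s) ^ p * g (Real.exp (-s)) ^ κ := by
    intro s
    have hgs := hg0 _ (Real.exp_pos (-s))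
    rw [Real.rpow_def_of_pos hgs, ← Real.exp_mul, ← Real.exp_add]
    congr 1
    simp only [hL]
    linear_combination (-s) * hκa
  have hmain := exists_tendsto_of_riccati (Y := Y) (L := L) (ε := ε) (s₀ := 0) (κ := κ)
    (K := |m| + C₀) hp hn hμ0 hμ hγ0 hγ hroot hκpos ?_ ?_ ?_ ?_
  · obtain ⟨l, hl⟩ := hmain
    refine ⟨Real.exp l, Real.exp_pos l, ?_⟩
    have h1 : Tendsto (fun r : ℝ => -Real.log r) (𝓝[>] 0) atTop :=
      tendsto_neg_atBot_atTop.comp Real.tendsto_log_nhdsGT_zero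
    refine ((Real.continuous_exp.tendsto l).comp (hl.comp h1)).congr' ?_
    filter_upwards [self_mem_nhdsWithin] with r (hr : 0 < r)
    simp only [Function.comp_apply, hL, neg_neg, Real.exp_log hr]
    rw [Real.exp_sub, Real.exp_log (hg0 r hr), mul_neg, Real.exp_neg, div_inv_eq_mul,
      mul_comm γ, Real.exp_mul, Real.exp_log hr]
  · intro s _
    have hr := Real.exp_pos (-s)
    obtain ⟨-, y', hy', he⟩ := hasDerivAt_riccati_variable (μ := μ) hp hr (hg0 _ hr) (hg _ hr)
      (hWd _ hr) (hW _ hr)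
    refine (HasDerivAt.comp s hy' (hexp s)).congr_deriv ?_
    rw [hYeq s]
    simp only [hε]
    linear_combination -he
  · intro s _
    have hr := Real.exp_pos (-s)
    rw [hYeq, spow_inv_spow hp1.ne']
    refine ((HasDerivAt.comp s (hg _ hr) (hexp s)).log (hg0 _ hr).ne').congr_deriv ?_
    simp only [Function.comp_apply]
    ring
  · intro s _
    rw [hLlog]
    have hr := Real.exp_pos (-s)
    have hgs := hg0 _ hr
    simp only [hε, hρ]
    have hrp : 0 < Real.exp (-s) ^ p := Real.rpow_pos_of_pos hr _
    have hE : Real.exp (-p * s) = Real.exp (-s) ^ p := by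
      rw [← Real.exp_mul]; congr 1; ring
    rw [hE]
    set r := Real.exp (-s) with hrdef
    set t := g r with ht
    have e1 : t ^ (p - 1) * t ^ (-(p - 1)) = 1 := by rw [← Real.rpow_add hgs]; simp
    have e2 : t ^ (n * p / (n - p) - 1) * t ^ (-(p - 1)) = t ^ κ := by
      rw [← Real.rpow_add hgs]; congr 1; rw [hκ]; ring
    have e3 : r ^ p * (μ / r ^ p * t ^ (p - 1) - m * t ^ (p - 1) + f t) * t ^ (-(p - 1)) - μ =
        r ^ p * (f t * t ^ (-(p - 1)) - m) := by
      have : r ^ p * (μ / r ^ p) = μ := by field_simp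
      linear_combination (r ^ p * (μ / r ^ p) - r ^ p * m) * e1 + this
    have e4 : |f t| * t ^ (-(p - 1)) ≤ C₀ * (1 + t ^ κ) := by
      calc _ ≤ C₀ * (t ^ (p - 1) + t ^ (n * p / (n - p) - 1)) * t ^ (-(p - 1)) := by
            gcongr; exact hf t hgs
        _ = _ := by linear_combination C₀ * e1 + C₀ * e2
    have htκ : 0 < t ^ κ := Real.rpow_pos_of_pos hgs _
    have e5 : |f t * t ^ (-(p - 1)) - m| ≤ |f t| * t ^ (-(p - 1)) + |m| := by
      refine (abs_sub _ _).trans_eq ?_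
      rw [abs_mul, abs_of_pos (Real.rpow_pos_of_pos hgs (-(p - 1)))]
    rw [e3, abs_mul, abs_of_pos hrp]
    have e6 : |f t * t ^ (-(p - 1)) - m| ≤ (|m| + C₀) * (1 + t ^ κ) := by
      have := mul_nonneg (abs_nonneg m) htκ.le
      linarith
    calc _ ≤ r ^ p * ((|m| + C₀) * (1 + t ^ κ)) := by gcongr
      _ = _ := by ring
  · have hdecay := tendsto_mul_rpow_critical hp hn hg hd (fun r hr => (hg0 r hr).le) hint
    have h1 : Tendsto (fun s : ℝ => Real.exp (-s)) atTop (𝓝[>] 0) :=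
      tendsto_nhdsWithin_iff.2 ⟨Real.tendsto_exp_neg_atTop_nhds_zero,
        Eventually.of_forall fun s => Real.exp_pos _⟩
    have h2 : Tendsto (fun s : ℝ => g (Real.exp (-s)) * Real.exp (-s) ^ a) atTop (𝓝[>] 0) :=
      tendsto_nhdsWithin_iff.2 ⟨hdecay.comp h1, Eventually.of_forall fun s =>
        mul_pos (hg0 _ (Real.exp_pos _)) (Real.rpow_pos_of_pos (Real.exp_pos _) _)⟩
    refine (Real.tendsto_log_nhdsGT_zero.comp h2).congr fun s => ?_
    simp only [Function.comp_apply, hL]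
    rw [Real.log_mul (hg0 _ (Real.exp_pos _)).ne' (Real.rpow_pos_of_pos (Real.exp_pos _) _).ne',
      ← Real.exp_mul, Real.log_exp]
    ring

/-! ### The strong maximum principle -/

/-- A zero of a nonnegative solution would be a zero of its flux as well, and would spread to a
whole interval to the right of it. -/
theorem pos_of_radial_solution {n p : ℝ} (hp : 1 < p) (hn : p < n) {g d W ρ : ℝ → ℝ}
    (hg0 : ∀ r, 0 < r → 0 ≤ g r) (hae : ∀ᵐ r : ℝ, 0 < r → 0 < g r)
    (hg : ∀ r, 0 < r → HasDerivAt g (d r) r)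
    (hWd : ∀ r, 0 < r → W r = r ^ (n - 1) * spow (p - 1) (d r))
    (hW : ∀ r, 0 < r → HasDerivAt W (-(r ^ (n - 1) * ρ r)) r)
    (hρ : ∀ a b, 0 < a → ∃ C, ∀ r ∈ Set.Icc a b, |ρ r| ≤ C * g r ^ (p - 1)) :
    ∀ r, 0 < r → 0 < g r := by
  have hp1 : 0 < p - 1 := by linarith
  intro r₀ hr₀
  by_contra! hle
  have hgr₀ : g r₀ = 0 := le_antisymm hle (hg0 r₀ hr₀)
  have hdr₀ : d r₀ = 0 := by
    refine IsLocalMin.hasDerivAt_eq_zero ?_ (hg r₀ hr₀)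
    filter_upwards [lt_mem_nhds hr₀] with r hr
    rw [hgr₀]; exact hg0 r hr
  have hWr₀ : W r₀ = 0 := by
    rw [hWd r₀ hr₀, hdr₀, spow_of_nonneg hp1.ne' le_rfl, Real.zero_rpow hp1.ne', mul_zero]
  obtain ⟨C, hC⟩ := hρ r₀ (r₀ + 1) hr₀
  set C₁ := (r₀ + 1) ^ (n - 1) * |C| with hC₁
  set C₂ := r₀ ^ (-(n - 1)) * C₁ with hC₂
  have hC₂0 : 0 ≤ C₂ := by positivity
  -- on `[r₀, r₀ + δ]` the equation gives `|g'| ≤ max g`, hence `max g ≤ δ max g`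
  set δ := min (1 / 2) (1 / (C₂ + 1)) with hδ
  have hδ0 : 0 < δ := by positivity
  have hδ1 : δ ≤ 1 / 2 := min_le_left _ _
  have hδ2 : C₂ * δ ≤ 1 := by
    have : C₂ * δ ≤ C₂ * (1 / (C₂ + 1)) := mul_le_mul_of_nonneg_left (min_le_right _ _) hC₂0
    refine this.trans ?_
    rw [mul_one_div, div_le_one (by positivity)]; linarith
  have hIpos : ∀ r ∈ Set.Icc r₀ (r₀ + δ), 0 < r := fun r hr => hr₀.trans_le hr.1
  obtain ⟨x, hx, hmax⟩ := isCompact_Icc.exists_isMaxOn (Set.nonempty_Icc.2 (by linarith))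
    (fun r hr => (hg r (hIpos r hr)).continuousAt.continuousWithinAt :
      ContinuousOn g (Set.Icc r₀ (r₀ + δ)))
  set M := g x with hM
  have hM0 : 0 ≤ M := hg0 x (hIpos x hx)
  have hMle : ∀ r ∈ Set.Icc r₀ (r₀ + δ), g r ≤ M := fun r hr => hmax hr
  have hWle : ∀ r ∈ Set.Icc r₀ (r₀ + δ), |W r| ≤ C₁ * M ^ (p - 1) * δ := by
    intro r hr
    have h1 : ∀ s ∈ Set.Icc r₀ (r₀ + δ), ‖-(s ^ (n - 1) * ρ s)‖ ≤ C₁ * M ^ (p - 1) := by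
      intro s hs
      have hs0 := hIpos s hs
      have h2 : |ρ s| ≤ |C| * M ^ (p - 1) := by
        refine (hC s ⟨hs.1, by linarith [hs.2]⟩).trans ?_
        have h3 : g s ^ (p - 1) ≤ M ^ (p - 1) :=
          Real.rpow_le_rpow (hg0 s hs0) (hMle s hs) hp1.le
        have h4 : 0 ≤ g s ^ (p - 1) := Real.rpow_nonneg (hg0 s hs0) _
        exact mul_le_mul (le_abs_self C) h3 h4 (abs_nonneg C)
      have h5 : s ^ (n - 1) ≤ (r₀ + 1) ^ (n - 1) :=
        Real.rpow_le_rpow hs0.le (by linarith [hs.2]) (by linarith)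
      rw [norm_neg, Real.norm_eq_abs, abs_mul, abs_of_pos (Real.rpow_pos_of_pos hs0 _), hC₁,
        mul_assoc]
      exact mul_le_mul h5 h2 (abs_nonneg _) (by positivity)
    have h2 := Convex.norm_image_sub_le_of_norm_hasDerivWithin_le (f := W) (x := r₀) (y := r)
      (fun s hs => (hW s (hIpos s hs)).hasDerivWithinAt) h1 (convex_Icc _ _)
      ⟨le_rfl, by linarith⟩ hr
    rw [hWr₀, sub_zero, Real.norm_eq_abs, Real.norm_eq_abs, abs_of_nonneg (sub_nonneg.2 hr.1)] at h2
    refine h2.trans (mul_le_mul_of_nonneg_left (by linarith [hr.2]) ?_)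
    have := Real.rpow_nonneg hM0 (p - 1)
    positivity
  have hdle : ∀ r ∈ Set.Icc r₀ (r₀ + δ), ‖d r‖ ≤ M := by
    intro r hr
    have hr0 := hIpos r hr
    have h1 : |d r| ^ (p - 1) = r ^ (-(n - 1)) * |W r| := by
      rw [hWd r hr0, abs_mul, abs_spow hp1.ne', abs_of_pos (Real.rpow_pos_of_pos hr0 _),
        ← mul_assoc, ← Real.rpow_add hr0]
      simp
    have h2 : r ^ (-(n - 1)) ≤ r₀ ^ (-(n - 1)) :=
      Real.rpow_le_rpow_of_nonpos hr₀ hr.1 (by linarith)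
    have hMp := Real.rpow_nonneg hM0 (p - 1)
    have h3 : |d r| ^ (p - 1) ≤ M ^ (p - 1) := by
      rw [h1]
      calc _ ≤ r₀ ^ (-(n - 1)) * (C₁ * M ^ (p - 1) * δ) :=
            mul_le_mul h2 (hWle r hr) (abs_nonneg _) (Real.rpow_nonneg hr₀.le _)
        _ = C₂ * δ * M ^ (p - 1) := by rw [hC₂]; ring
        _ ≤ 1 * M ^ (p - 1) := by gcongr
        _ = _ := one_mul _
    exact (Real.rpow_le_rpow_iff (abs_nonneg _) hM0 hp1).1 h3
  have hMzero : M = 0 := by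
    have h2 := Convex.norm_image_sub_le_of_norm_hasDerivWithin_le (f := g) (x := r₀) (y := x)
      (fun s hs => (hg s (hIpos s hs)).hasDerivWithinAt) hdle (convex_Icc _ _)
      ⟨le_rfl, by linarith⟩ hx
    rw [hgr₀, sub_zero, Real.norm_eq_abs, Real.norm_eq_abs, abs_of_nonneg (sub_nonneg.2 hx.1),
      abs_of_nonneg hM0] at h2
    have : M * (x - r₀) ≤ M * (1 / 2) := mul_le_mul_of_nonneg_left (by linarith [hx.2]) hM0
    linarith
  obtain ⟨r, hr, hr'⟩ : ∃ r ∈ Set.Ioo r₀ (r₀ + δ), (0 < r → 0 < g r) := by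
    by_contra! hcon
    have h1 : Set.Ioo r₀ (r₀ + δ) ⊆ {r | ¬(0 < r → 0 < g r)} := fun r hr h =>
      absurd (h (hcon r hr).1) (not_lt.2 (hcon r hr).2)
    have h2 := measure_mono_null h1 (ae_iff.1 hae)
    rw [Real.volume_Ioo, ENNReal.ofReal_eq_zero] at h2
    linarith
  have := hMle r ⟨hr.1.le, hr.2.le⟩
  linarith [hr' (hr₀.trans hr.1)]

/-! ### Weak derivatives on the half-line -/

/-- Test functions on the open half-line `(0, ∞)`. -/
def IsHalfLineTest (ζ : ℝ → ℝ) : Prop :=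
  ContDiff ℝ ∞ ζ ∧ HasCompactSupport ζ ∧ tsupport ζ ⊆ Set.Ioi 0

theorem exists_Ioo_of_isCompact {K : Set ℝ} (hK : IsCompact K) (h0 : K ⊆ Set.Ioi 0) :
    ∃ a b : ℝ, 0 < a ∧ a < 1 ∧ 1 < b ∧ K ⊆ Set.Ioo a b := by
  obtain ⟨b, hb⟩ := hK.bddAbove
  obtain ⟨a, ha, haK⟩ : ∃ a : ℝ, 0 < a ∧ ∀ x ∈ K, a ≤ x := by
    rcases K.eq_empty_or_nonempty with rfl | hne
    · exact ⟨1, one_pos, by simp⟩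
    · obtain ⟨a, ha⟩ := hK.exists_isLeast hne
      exact ⟨a, h0 ha.1, fun x hx => ha.2 hx⟩
  refine ⟨min a 1 / 2, max b 1 + 1, by positivity, ?_, ?_, fun x hx => ⟨?_, ?_⟩⟩
  · have := min_le_right a 1; linarith
  · have := le_max_right b 1; linarith
  · have h1 := min_le_left a 1
    have h2 : 0 < min a 1 := by positivity
    have := haK x hx; linarith
  · have := hb hx; have := le_max_left b 1; linarith

theorem IsHalfLineTest.exists_Ioo {ζ : ℝ → ℝ} (hζ : IsHalfLineTest ζ) :
    ∃ a b : ℝ, 0 < a ∧ a < 1 ∧ 1 < b ∧ tsupport ζ ⊆ Set.Ioo a b :=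
  exists_Ioo_of_isCompact hζ.2.1 hζ.2.2

theorem eq_zero_of_tsupport_subset {ζ : ℝ → ℝ} {S : Set ℝ} (h : tsupport ζ ⊆ S) {x : ℝ}
    (hx : x ∉ S) : ζ x = 0 :=
  image_eq_zero_of_notMem_tsupport fun h' => hx (h h')

theorem deriv_eq_zero_of_tsupport_subset {ζ : ℝ → ℝ} {S : Set ℝ} (h : tsupport ζ ⊆ S) {x : ℝ}
    (hx : x ∉ S) : deriv ζ x = 0 := by
  by_contra h'
  exact hx (h (support_deriv_subset h'))

theorem integral_Ioi_eq_intervalIntegral {F : ℝ → ℝ} {a b : ℝ} (ha : 0 < a) (hab : a ≤ b)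
    (hF : ∀ x, 0 < x → x ∉ Set.Ioo a b → F x = 0) : ∫ x in Set.Ioi 0, F x = ∫ x in a..b, F x := by
  rw [intervalIntegral.integral_of_le hab]
  refine setIntegral_eq_of_subset_of_forall_sdiff_eq_zero measurableSet_Ioi
    (fun x hx => ha.trans hx.1) fun x hx => hF x hx.1 fun h => hx.2 ⟨h.1, h.2.le⟩

theorem intervalIntegrable_of_locallyIntegrableOn {k : ℝ → ℝ}
    (hk : LocallyIntegrableOn k (Set.Ioi 0)) {a b : ℝ} (ha : 0 < a) (hb : 0 < b) :
    IntervalIntegrable k volume a b := by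
  have hsub : Set.uIcc a b ⊆ Set.Ioi 0 := fun x hx => (lt_min ha hb).trans_le hx.1
  exact (hk.integrableOn_compact_subset hsub isCompact_uIcc).intervalIntegrable

theorem integrableOn_mul_of_tsupport {k ζ : ℝ → ℝ} (hk : LocallyIntegrableOn k (Set.Ioi 0))
    (hζ : Continuous ζ) {a b : ℝ} (ha : 0 < a) (h : ∀ x, x ∉ Set.Ioo a b → ζ x = 0) :
    IntegrableOn (fun x => k x * ζ x) (Set.Ioi 0) := by
  have hsub : Set.Icc a b ⊆ Set.Ioi 0 := fun x hx => ha.trans_le hx.1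
  have h1 : IntegrableOn (fun x => k x * ζ x) (Set.Icc a b) :=
    (hk.integrableOn_compact_subset hsub isCompact_Icc).mul_continuousOn hζ.continuousOn
      isCompact_Icc
  refine h1.of_forall_sdiff_eq_zero measurableSet_Ioi fun x hx => ?_
  rw [h x fun h' => hx.2 ⟨h'.1.le, h'.2.le⟩, mul_zero]

theorem IsHalfLineTest.integrableOn_mul {k ζ : ℝ → ℝ} (hζ : IsHalfLineTest ζ)
    (hk : LocallyIntegrableOn k (Set.Ioi 0)) :
    IntegrableOn (fun x => k x * ζ x) (Set.Ioi 0) := by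
  obtain ⟨a, b, ha, -, -, hab⟩ := hζ.exists_Ioo
  exact integrableOn_mul_of_tsupport hk hζ.1.continuous ha
    fun x hx => eq_zero_of_tsupport_subset hab hx

theorem IsHalfLineTest.integrableOn_mul_deriv {k ζ : ℝ → ℝ} (hζ : IsHalfLineTest ζ)
    (hk : LocallyIntegrableOn k (Set.Ioi 0)) :
    IntegrableOn (fun x => k x * deriv ζ x) (Set.Ioi 0) := by
  obtain ⟨a, b, ha, -, -, hab⟩ := hζ.exists_Ioo
  exact integrableOn_mul_of_tsupport hk (hζ.1.continuous_deriv (by simp)) ha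
    fun x hx => deriv_eq_zero_of_tsupport_subset hab hx

/-- The primitive, normalized at `1`, of a locally integrable function on `(0, ∞)`. -/
noncomputable def primitive (l : ℝ → ℝ) (r : ℝ) : ℝ := ∫ t in (1 : ℝ)..r, l t

theorem absolutelyContinuous_primitive {l : ℝ → ℝ} (hl : LocallyIntegrableOn l (Set.Ioi 0))
    {a b : ℝ} (ha : 0 < a) (ha1 : a < 1) (hb1 : 1 < b) :
    AbsolutelyContinuousOnInterval (primitive l) a b :=
  (intervalIntegrable_of_locallyIntegrableOn hl ha
    (by linarith)).absolutelyContinuousOnInterval_intervalIntegral (c := 1)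
      (by rw [Set.uIcc_of_le (by linarith)]; exact ⟨ha1.le, hb1.le⟩)

theorem continuousOn_primitive {l : ℝ → ℝ} (hl : LocallyIntegrableOn l (Set.Ioi 0)) :
    ContinuousOn (primitive l) (Set.Ioi 0) := by
  intro r (hr : 0 < r)
  obtain ⟨a, b, ha, ha1, hb1, hab⟩ := exists_Ioo_of_isCompact (isCompact_singleton (x := r))
    (by simpa using hr)
  have h1 := (absolutelyContinuous_primitive hl ha ha1 hb1).continuousOn
  rw [Set.uIcc_of_le (by linarith)] at h1
  have hr' : r ∈ Set.Ioo a b := hab rfl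
  exact (h1.continuousAt (Icc_mem_nhds hr'.1 hr'.2)).continuousWithinAt

theorem locallyIntegrableOn_primitive {l : ℝ → ℝ} (hl : LocallyIntegrableOn l (Set.Ioi 0)) :
    LocallyIntegrableOn (primitive l) (Set.Ioi 0) :=
  (continuousOn_primitive hl).locallyIntegrableOn measurableSet_Ioi

theorem deriv_primitive_ae {l : ℝ → ℝ} (hl : LocallyIntegrableOn l (Set.Ioi 0))
    {a b : ℝ} (ha : 0 < a) (ha1 : a < 1) (hb1 : 1 < b) :
    ∀ᵐ r, r ∈ Set.uIcc a b → deriv (primitive l) r = l r := by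
  have := (intervalIntegrable_of_locallyIntegrableOn hl ha
    (by linarith : 0 < b)).ae_hasDerivAt_integral
  filter_upwards [this] with r hr hr'
  exact (hr hr' 1 (by rw [Set.uIcc_of_le (by linarith)]; exact ⟨ha1.le, hb1.le⟩)).deriv

/-- Integration by parts for two primitives of locally integrable functions, one of which
vanishes outside of a compact subinterval. -/
theorem integral_primitive_mul {k l Z ζ : ℝ → ℝ} (hl : LocallyIntegrableOn l (Set.Ioi 0))
    (hζ : LocallyIntegrableOn ζ (Set.Ioi 0)) {c c' : ℝ}
    (hk : ∀ᵐ r, 0 < r → k r = c + primitive l r)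
    (hZ : ∀ᵐ r, 0 < r → Z r = c' + primitive ζ r)
    {a b : ℝ} (ha : 0 < a) (ha1 : a < 1) (hb1 : 1 < b)
    (hZ0 : ∀ r, 0 < r → r ∉ Set.Ioo a b → c' + primitive ζ r = 0)
    (hZ0' : ∀ r, 0 < r → r ∉ Set.Ioo a b → Z r = 0)
    (hζ0 : ∀ r, 0 < r → r ∉ Set.Ioo a b → ζ r = 0) :
    ∫ r in Set.Ioi 0, k r * ζ r = -∫ r in Set.Ioi 0, l r * Z r := by
  have hab : a ≤ b := by linarith
  rw [integral_Ioi_eq_intervalIntegral ha hab fun x h0 hx => by rw [hζ0 x h0 hx, mul_zero],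
    integral_Ioi_eq_intervalIntegral ha hab fun x h0 hx => by rw [hZ0' x h0 hx, mul_zero]]
  have hc : ∀ c : ℝ, AbsolutelyContinuousOnInterval (fun _ : ℝ => c) a b := fun c =>
    ContDiffOn.absolutelyContinuousOnInterval contDiffOn_const
  have h1 :=
    ((hc c).add (absolutelyContinuous_primitive hl ha ha1 hb1)).integral_mul_deriv_eq_deriv_mul
    ((hc c').add (absolutelyContinuous_primitive hζ ha ha1 hb1))
  simp only [Pi.add_apply, hZ0 a ha (fun h => lt_irrefl _ h.1),
    hZ0 b (by linarith) (fun h => lt_irrefl _ h.2), mul_zero, sub_zero, zero_sub] at h1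
  have hsub : ∀ x ∈ Set.uIoc a b, x ∈ Set.uIcc a b ∧ 0 < x := fun x hx =>
    ⟨Set.uIoc_subset_uIcc hx, ha.trans (by rw [Set.uIoc_of_le hab] at hx; exact hx.1)⟩
  have hd : ∀ (e : ℝ) (h : ℝ → ℝ) (x : ℝ),
      deriv ((fun _ => e) + primitive h) x = deriv (primitive h) x := fun e h x =>
    deriv_const_add (f := primitive h) e
  have e1 : ∫ x in a..b, k x * ζ x =
      ∫ x in a..b, (c + primitive l x) * deriv ((fun _ => c') + primitive ζ) x := by
    refine intervalIntegral.integral_congr_ae ?_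
    filter_upwards [hk, deriv_primitive_ae hζ ha ha1 hb1] with x h2 h3 hx
    rw [h2 (hsub x hx).2, hd, h3 (hsub x hx).1]
  have e2 : ∫ x in a..b, l x * Z x =
      ∫ x in a..b, deriv ((fun _ => c) + primitive l) x * (c' + primitive ζ x) := by
    refine intervalIntegral.integral_congr_ae ?_
    filter_upwards [hZ, deriv_primitive_ae hl ha ha1 hb1] with x h2 h3 hx
    rw [h2 (hsub x hx).2, hd, h3 (hsub x hx).1]
  rw [e1, e2, h1]

theorem IsHalfLineTest.integral_primitive_mul_deriv {l ζ : ℝ → ℝ} (hζ : IsHalfLineTest ζ)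
    (hl : LocallyIntegrableOn l (Set.Ioi 0)) :
    ∫ r in Set.Ioi 0, primitive l r * deriv ζ r = -∫ r in Set.Ioi 0, l r * ζ r := by
  obtain ⟨a, b, ha, ha1, hb1, hab⟩ := hζ.exists_Ioo
  have hcd : Continuous (deriv ζ) := hζ.1.continuous_deriv (by simp)
  have hprim : ∀ r, ζ 1 + primitive (deriv ζ) r = ζ r := fun r => by
    have := intervalIntegral.integral_eq_sub_of_hasDerivAt (a := 1) (b := r)
      (fun x _ => (hζ.1.differentiable (by simp)).differentiableAt.hasDerivAt)
      (hcd.intervalIntegrable 1 r)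
    rw [primitive, this]; ring
  refine integral_primitive_mul (c := 0) (c' := ζ 1) hl
    (hcd.locallyIntegrable.locallyIntegrableOn _) (by simp) (by simp [hprim]) ha ha1 hb1 ?_ ?_ ?_
  · exact fun r _ hr => by rw [hprim, eq_zero_of_tsupport_subset hab hr]
  · exact fun r _ hr => eq_zero_of_tsupport_subset hab hr
  · exact fun r _ hr => deriv_eq_zero_of_tsupport_subset hab hr

/-- Every test function is dominated by a nonnegative one, hence is a difference of two nonnegative
test functions. -/
theorem IsHalfLineTest.exists_cutoff {ζ : ℝ → ℝ} (hζ : IsHalfLineTest ζ) :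
    ∃ χ, IsHalfLineTest χ ∧ (∀ x, 0 ≤ χ x) ∧ ∀ x, |ζ x| ≤ χ x := by
  obtain ⟨a, b, ha, ha1, hb1, hab⟩ := hζ.exists_Ioo
  obtain ⟨M, hM⟩ := hζ.2.1.exists_bound_of_continuous hζ.1.continuous
  have hM0 : 0 ≤ M := (norm_nonneg _).trans (hM 0)
  let B : ContDiffBump ((a + b) / 2) :=
    ⟨(b - a) / 2, (b - a) / 2 + a / 2, by linarith, by linarith⟩
  refine ⟨fun x => M * B x, ⟨contDiff_const.mul B.contDiff, B.hasCompactSupport.mul_left, ?_⟩,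
    fun x => mul_nonneg hM0 B.nonneg, fun x => ?_⟩
  · refine (tsupport_mul_subset_right (f := fun _ => M) (g := B)).trans ?_
    rw [B.tsupport_eq, Real.closedBall_eq_Icc]
    intro x hx
    have := hx.1
    change (a + b) / 2 - ((b - a) / 2 + a / 2) ≤ x at this
    change 0 < x
    linarith
  · by_cases hx : x ∈ Set.Ioo a b
    · have : B x = 1 := by
        refine B.one_of_mem_closedBall ?_
        rw [Real.closedBall_eq_Icc]
        change x ∈ Set.Icc ((a + b) / 2 - (b - a) / 2) ((a + b) / 2 + (b - a) / 2)
        exact ⟨by linarith [hx.1], by linarith [hx.2]⟩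
      simp only [this, mul_one]
      exact hM x
    · rw [eq_zero_of_tsupport_subset hab hx, abs_zero]
      exact mul_nonneg hM0 B.nonneg

theorem IsHalfLineTest.add {ζ χ : ℝ → ℝ} (hζ : IsHalfLineTest ζ) (hχ : IsHalfLineTest χ) :
    IsHalfLineTest (ζ + χ) :=
  ⟨hζ.1.add hχ.1, hζ.2.1.add hχ.2.1, (tsupport_add ζ χ).trans (Set.union_subset hζ.2.2 hχ.2.2)⟩

/-- A test function on `(0, ∞)` with vanishing integral has a primitive which is a test function. -/
theorem IsHalfLineTest.exists_deriv_eq {θ : ℝ → ℝ} (hθ : IsHalfLineTest θ)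
    (h0 : ∫ x in Set.Ioi 0, θ x = 0) : ∃ ζ, IsHalfLineTest ζ ∧ deriv ζ = θ := by
  obtain ⟨a, b, ha, ha1, hb1, hab⟩ := hθ.exists_Ioo
  have hder : ∀ x, HasDerivAt (fun x => ∫ t in a..x, θ t) (θ x) x := fun x =>
    intervalIntegral.integral_hasDerivAt_right (hθ.1.continuous.intervalIntegrable _ _)
      hθ.1.continuous.aestronglyMeasurable.stronglyMeasurableAtFilter hθ.1.continuous.continuousAt
  have hd : deriv (fun x => ∫ t in a..x, θ t) = θ := funext fun x => (hder x).deriv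
  have hsupp : ∀ x, x ∉ Set.Icc a b → ∫ t in a..x, θ t = 0 := by
    intro x hx
    rcases lt_or_ge x a with h | h
    · rw [intervalIntegral.integral_symm, intervalIntegral.integral_of_le h.le,
        setIntegral_eq_zero_of_forall_eq_zero, neg_zero]
      exact fun t ht => eq_zero_of_tsupport_subset hab fun h' => by linarith [h'.1, ht.2]
    · have hbx : b < x := by
        by_contra! h'
        exact hx ⟨h, h'⟩
      rw [← integral_Ioi_eq_intervalIntegral ha h, h0]
      exact fun t _ ht => eq_zero_of_tsupport_subset hab fun h' => ht ⟨h'.1, h'.2.trans hbx⟩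
  have hts : tsupport (fun x => ∫ t in a..x, θ t) ⊆ Set.Icc a b :=
    closure_minimal (fun x hx => by
      by_contra h
      exact hx (hsupp x h)) isClosed_Icc
  refine ⟨_, ⟨?_, ?_, hts.trans fun x hx => ha.trans_le hx.1⟩, hd⟩
  · rw [contDiff_infty_iff_deriv, hd]
    exact ⟨fun x => (hder x).differentiableAt, hθ.1⟩
  · exact HasCompactSupport.intro isCompact_Icc hsupp

/-- The lemma of du Bois-Reymond, with nonnegative test functions: a function with locally
integrable weak derivative `l` on `(0, ∞)` is a primitive of `l`. -/
theorem exists_eq_primitive {k l : ℝ → ℝ} (hk : LocallyIntegrableOn k (Set.Ioi 0))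
    (hl : LocallyIntegrableOn l (Set.Ioi 0))
    (h : ∀ ζ, IsHalfLineTest ζ → (∀ x, 0 ≤ ζ x) →
      ∫ r in Set.Ioi 0, k r * deriv ζ r = -∫ r in Set.Ioi 0, l r * ζ r) :
    ∃ c, ∀ᵐ r, 0 < r → k r = c + primitive l r := by
  have hall : ∀ ζ, IsHalfLineTest ζ →
      ∫ r in Set.Ioi 0, k r * deriv ζ r = -∫ r in Set.Ioi 0, l r * ζ r := by
    intro ζ hζ
    obtain ⟨χ, hχ, hχ0, hζχ⟩ := hζ.exists_cutoff
    have h1 := h χ hχ hχ0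
    have h2 := h (ζ + χ) (hζ.add hχ) fun x => by
      have := (abs_le.1 (hζχ x)).1
      simp only [Pi.add_apply]; linarith
    have h3 : ∀ x, deriv (ζ + χ) x = deriv ζ x + deriv χ x := fun x =>
      deriv_add (hζ.1.differentiable (by simp)).differentiableAt
        (hχ.1.differentiable (by simp)).differentiableAt
    simp only [h3, Pi.add_apply, mul_add] at h2
    rw [integral_add (hζ.integrableOn_mul_deriv hk) (hχ.integrableOn_mul_deriv hk),
      integral_add (hζ.integrableOn_mul hl) (hχ.integrableOn_mul hl), h1] at h2
    linarith
  have hP := locallyIntegrableOn_primitive hl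
  -- the difference `D` has zero weak derivative, and testing it with `ψ - (∫ ψ) ψ₀` for a fixed
  -- `ψ₀` of integral one shows that it equals the constant `∫ D ψ₀`
  let D : ℝ → ℝ := fun r => k r - primitive l r
  have hD : LocallyIntegrableOn D (Set.Ioi 0) := hk.sub hP
  have hD0 : ∀ ζ, IsHalfLineTest ζ → ∫ r in Set.Ioi 0, D r * deriv ζ r = 0 := by
    intro ζ hζ
    simp only [D, sub_mul]
    rw [integral_sub (hζ.integrableOn_mul_deriv hk) (hζ.integrableOn_mul_deriv hP), hall ζ hζ,
      hζ.integral_primitive_mul_deriv hl, sub_self]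
  let B : ContDiffBump (1 : ℝ) := ⟨1 / 4, 1 / 2, by norm_num, by norm_num⟩
  let ψ₀ : ℝ → ℝ := B.normed volume
  have hψ₀ : IsHalfLineTest ψ₀ := by
    refine ⟨B.contDiff_normed, B.hasCompactSupport_normed, ?_⟩
    rw [B.tsupport_normed_eq, Real.closedBall_eq_Icc]
    intro x hx
    have := hx.1
    change 1 - 1 / 2 ≤ x at this
    change 0 < x
    linarith
  have hset : ∀ {F ζ : ℝ → ℝ}, IsHalfLineTest ζ →
      ∫ r in Set.Ioi 0, F r * ζ r = ∫ r, F r * ζ r := fun hζ =>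
    setIntegral_eq_integral_of_forall_compl_eq_zero fun x hx => by
      rw [eq_zero_of_tsupport_subset hζ.2.2 hx, mul_zero]
  have hψ₀1 : ∫ r in Set.Ioi 0, ψ₀ r = 1 := by
    have := hset (F := fun _ => 1) hψ₀
    simp only [one_mul] at this
    rw [this]; exact B.integral_normed
  set c := ∫ r in Set.Ioi 0, D r * ψ₀ r with hc
  refine ⟨c, ?_⟩
  have hmain : ∀ᵐ r : ℝ, r ∈ Set.Ioi (0 : ℝ) → D r - c = 0 := by
    have hc' : LocallyIntegrableOn (fun _ : ℝ => c) (Set.Ioi 0) :=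
      (continuous_const.locallyIntegrable).locallyIntegrableOn _
    refine isOpen_Ioi.ae_eq_zero_of_integral_contDiff_smul_eq_zero (hD.sub hc') ?_
    intro ψ hψ1 hψ2 hψ3
    have hψ : IsHalfLineTest ψ := ⟨hψ1, hψ2, hψ3⟩
    set I := ∫ r in Set.Ioi 0, ψ r with hI
    have hIψ₀ : IsHalfLineTest (fun r => -I * ψ₀ r) :=
      ⟨contDiff_const.mul hψ₀.1, hψ₀.2.1.mul_left,
        (tsupport_mul_subset_right (f := fun _ => -I) (g := ψ₀)).trans hψ₀.2.2⟩
    have hi : ∀ {ζ}, IsHalfLineTest ζ → IntegrableOn ζ (Set.Ioi 0) := fun hζ =>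
      (hζ.1.continuous.integrable_of_hasCompactSupport hζ.2.1).integrableOn
    obtain ⟨ζ, hζ, hζd⟩ := (hψ.add hIψ₀).exists_deriv_eq (by
      simp only [Pi.add_apply]
      rw [integral_add (hi hψ) (hi hIψ₀), integral_const_mul, hψ₀1]; ring)
    have h1 := hD0 ζ hζ
    rw [hζd] at h1
    simp only [Pi.add_apply, mul_add] at h1
    rw [integral_add (hψ.integrableOn_mul hD) (hIψ₀.integrableOn_mul hD)] at h1
    have h2 : ∫ r in Set.Ioi 0, D r * (-I * ψ₀ r) = -I * c := by
      rw [hc, ← integral_const_mul]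
      congr 1; ext r; ring
    have h3 : ∫ r, ψ r • (D r - c) = ∫ r in Set.Ioi 0, (D r * ψ r - c * ψ r) := by
      rw [← setIntegral_eq_integral_of_forall_compl_eq_zero (s := Set.Ioi (0 : ℝ)) fun x hx => by
        rw [eq_zero_of_tsupport_subset hψ.2.2 hx, zero_smul]]
      congr 1; ext r; rw [smul_eq_mul]; ring
    rw [h2] at h1
    change ∫ r, ψ r • (D r - c) = 0
    rw [h3, integral_sub (hψ.integrableOn_mul hD) ((hi hψ).const_mul c), integral_const_mul]
    linarith
  filter_upwards [hmain] with r hr hr0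
  have := hr hr0
  simp only [D] at this
  linarith

/-! ### Polar coordinates -/

section Polar

variable {E : Type*} [NormedAddCommGroup E] [InnerProductSpace ℝ E] [FiniteDimensional ℝ E]
  [MeasurableSpace E] [BorelSpace E]

/-- The integral of `F` over the sphere of radius `r`, with respect to the surface measure of the
unit sphere. -/
noncomputable def sphereInt (F : E → ℝ) (r : ℝ) : ℝ :=
  ∫ w : Metric.sphere (0 : E) 1, F (r • (w : E)) ∂(volume : Measure E).toSphere

theorem sphereInt_norm_mul (ζ : ℝ → ℝ) (F : E → ℝ) {r : ℝ} (hr : 0 < r) :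
    sphereInt (fun x => ζ ‖x‖ * F x) r = ζ r * sphereInt F r := by
  simp only [sphereInt]
  rw [← integral_const_mul]
  congr 1; ext w
  rw [norm_smul, norm_eq_of_mem_sphere, mul_one, Real.norm_eq_abs, abs_of_pos hr]

theorem sphereInt_norm (ζ : ℝ → ℝ) {r : ℝ} (hr : 0 < r) :
    sphereInt (fun x : E => ζ ‖x‖) r = (volume : Measure E).toSphere.real Set.univ * ζ r := by
  have := sphereInt_norm_mul (E := E) ζ (fun _ => 1) hr
  simp only [mul_one] at this
  rw [this, sphereInt, integral_const, smul_eq_mul, mul_one, mul_comm]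

theorem sphereInt_eq_zero {F : E → ℝ} {r : ℝ} (hr : 0 < r) (h : ∀ x, ‖x‖ = r → F x = 0) :
    sphereInt F r = 0 := by
  rw [sphereInt]
  refine integral_eq_zero_of_ae (Eventually.of_forall fun w => h _ ?_)
  rw [norm_smul, norm_eq_of_mem_sphere, mul_one, Real.norm_eq_abs, abs_of_pos hr]

theorem ae_volumeIoiPow_iff {k : ℕ} {Q : ℝ → Prop} :
    (∀ᵐ r : Set.Ioi (0 : ℝ) ∂(Measure.volumeIoiPow k), Q r) ↔ ∀ᵐ r : ℝ, 0 < r → Q r := by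
  rw [Measure.volumeIoiPow, ae_withDensity_iff (by fun_prop),
    show (∀ᵐ r : ℝ, 0 < r → Q r) ↔ ∀ᵐ r : Set.Ioi (0 : ℝ)
        ∂((volume : Measure ℝ).comap Subtype.val), Q r from by
      rw [← ae_restrict_iff_subtype measurableSet_Ioi, ae_restrict_iff' measurableSet_Ioi]; rfl]
  refine eventually_congr (Eventually.of_forall fun r => ⟨fun h => h ?_, fun h _ => h⟩)
  simpa using pow_pos r.2.out k

theorem integrable_volumeIoiPow_iff {k : ℕ} {H : ℝ → ℝ} :
    Integrable (fun r : Set.Ioi (0 : ℝ) => H r) (Measure.volumeIoiPow k) ↔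
      IntegrableOn (fun r => r ^ k * H r) (Set.Ioi 0) := by
  rw [Measure.volumeIoiPow, integrable_withDensity_iff_integrable_smul' (by fun_prop) (by simp),
    integrableOn_iff_comap_subtypeVal measurableSet_Ioi]
  refine integrable_congr (Eventually.of_forall fun r => ?_)
  have hr : (0 : ℝ) < r := r.2
  simp [ENNReal.toReal_ofReal (pow_pos hr k).le]

theorem integral_volumeIoiPow {k : ℕ} {H : ℝ → ℝ} :
    ∫ r : Set.Ioi (0 : ℝ), H r ∂(Measure.volumeIoiPow k) = ∫ r in Set.Ioi 0, r ^ k * H r := by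
  simp only [Measure.volumeIoiPow, ENNReal.ofReal]
  rw [integral_withDensity_eq_integral_smul (by fun_prop),
    integral_subtype_comap measurableSet_Ioi fun a ↦ Real.toNNReal (a ^ k) • H a]
  refine setIntegral_congr_fun measurableSet_Ioi fun x hx => ?_
  rw [NNReal.smul_def, Real.coe_toNNReal _ (pow_nonneg hx.out.le _), smul_eq_mul]

theorem integrable_norm_mul_of_locallyIntegrable {F : E → ℝ} (hF : LocallyIntegrable F)
    {ζ : ℝ → ℝ} (hζ : Continuous ζ) {b : ℝ} (h : ∀ r, b ≤ r → ζ r = 0) :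
    Integrable (fun x => ζ ‖x‖ * F x) := by
  refine hF.integrable_smul_left_of_hasCompactSupport (hζ.comp continuous_norm) ?_
  refine HasCompactSupport.intro (isCompact_closedBall (0 : E) b) fun x hx => h _ ?_
  simpa using (not_le.1 (by simpa using hx)).le

/-- Inverse polar coordinates preserve the measure. -/
theorem measurePreserving_polar_symm :
    MeasurePreserving (homeomorphUnitSphereProd E).symm
      ((volume : Measure E).toSphere.prod (.volumeIoiPow (Module.finrank ℝ E - 1)))
      ((volume : Measure E).comap (↑)) :=
  MeasurePreserving.symm (homeomorphUnitSphereProd E).toMeasurableEquiv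
    (volume : Measure E).measurePreserving_homeomorphUnitSphereProd

variable [Nontrivial E]

/-- A property holds at almost every radius if and only if it holds at the norm of almost every
point. Measurability of the property is not needed. -/
theorem ae_norm_iff {Q : ℝ → Prop} :
    (∀ᵐ x : E, Q ‖x‖) ↔ ∀ᵐ r : ℝ, 0 < r → Q r := by
  have h0 : (∀ᵐ x : E, Q ‖x‖) ↔
      ∀ᵐ x : ({0}ᶜ : Set E) ∂((volume : Measure E).comap (↑)), Q ‖(x : E)‖ := by
    rw [← ae_restrict_iff_subtype (measurableSet_singleton (0 : E)).compl (p := fun x => Q ‖x‖),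
      restrict_compl_singleton]
  rw [h0, ← ae_volumeIoiPow_iff (k := Module.finrank ℝ E - 1)]
  have hmp := (volume : Measure E).measurePreserving_homeomorphUnitSphereProd
  constructor
  · intro h
    have h1 := (measurePreserving_polar_symm (E := E)).quasiMeasurePreserving.ae h
    have h2 := Measure.ae_ae_of_ae_prod h1
    have : NeZero (volume : Measure E).toSphere := ⟨(volume : Measure E).toSphere_ne_zero⟩
    obtain ⟨w, hw⟩ := h2.exists
    filter_upwards [hw] with r hr
    have hr0 : (0 : ℝ) < r := r.2
    rwa [homeomorphUnitSphereProd_symm_apply_coe, norm_smul, norm_eq_of_mem_sphere, mul_one,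
      Real.norm_eq_abs, abs_of_pos hr0] at hr
  · intro h
    have h1 := (Measure.quasiMeasurePreserving_snd
      (μ := (volume : Measure E).toSphere)).ae h
    have h2 := hmp.quasiMeasurePreserving.ae h1
    filter_upwards [h2] with x hx
    rwa [homeomorphUnitSphereProd_apply_snd_coe] at hx

/-- Integration in polar coordinates. -/
theorem integral_polar {F : E → ℝ} (hF : Integrable F) :
    IntegrableOn (fun r => r ^ (Module.finrank ℝ E - 1) * sphereInt F r) (Set.Ioi 0) ∧
      ∫ x, F x = ∫ r in Set.Ioi 0, r ^ (Module.finrank ℝ E - 1) * sphereInt F r := by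
  have hme := (homeomorphUnitSphereProd E).symm.measurableEmbedding
  have hmp := measurePreserving_polar_symm (E := E)
  have hms := (measurableSet_singleton (0 : E)).compl
  have h1 : Integrable (fun x : ({0}ᶜ : Set E) => F x) ((volume : Measure E).comap (↑)) := by
    have := hF.integrableOn (s := ({0}ᶜ : Set E))
    rwa [integrableOn_iff_comap_subtypeVal hms] at this
  have h2 : Integrable (fun z : Metric.sphere (0 : E) 1 × Set.Ioi (0 : ℝ) => F (z.2.1 • z.1.1))
      ((volume : Measure E).toSphere.prod (.volumeIoiPow (Module.finrank ℝ E - 1))) := by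
    simpa [Function.comp_def] using (hmp.integrable_comp_emb hme).2 h1
  have h3 : ∫ x : ({0}ᶜ : Set E), F x ∂((volume : Measure E).comap (↑)) =
      ∫ z : Metric.sphere (0 : E) 1 × Set.Ioi (0 : ℝ), F (z.2.1 • z.1.1)
        ∂((volume : Measure E).toSphere.prod (.volumeIoiPow (Module.finrank ℝ E - 1))) := by
    rw [← hmp.integral_comp hme]
    simp only [homeomorphUnitSphereProd_symm_apply_coe]
  rw [integral_prod_symm _ h2, integral_subtype_comap hms F, restrict_compl_singleton] at h3
  have h4 : Integrable (fun r : Set.Ioi (0 : ℝ) => sphereInt F r)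
      (.volumeIoiPow (Module.finrank ℝ E - 1)) := h2.integral_prod_right
  have h5 := integrable_volumeIoiPow_iff.1 h4
  refine ⟨h5, ?_⟩
  rw [← integral_volumeIoiPow]
  exact h3

/-- For radial functions no integrability is needed. -/
theorem integral_norm_polar (F : ℝ → ℝ) :
    ∫ x : E, F ‖x‖ = (volume : Measure E).toSphere.real Set.univ *
      ∫ r in Set.Ioi 0, r ^ (Module.finrank ℝ E - 1) * F r := by
  rw [integral_fun_norm_addHaar, Measure.toSphere_real_apply_univ, nsmul_eq_mul, smul_eq_mul,
    mul_assoc]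
  simp only [smul_eq_mul]

theorem toSphere_real_univ_pos : 0 < (volume : Measure E).toSphere.real Set.univ := by
  rw [measureReal_def]
  refine ENNReal.toReal_pos ?_ (measure_ne_top _ _)
  rw [Ne, Measure.measure_univ_eq_zero]
  exact (volume : Measure E).toSphere_ne_zero

/-- The spherical integrals of a locally integrable function are locally integrable. -/
theorem locallyIntegrableOn_sphereInt {F : E → ℝ} (hF : LocallyIntegrable F) :
    LocallyIntegrableOn (sphereInt F) (Set.Ioi 0) := by
  rw [locallyIntegrableOn_iff isOpen_Ioi.isLocallyClosed]
  intro K hK0 hK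
  obtain ⟨a, b, ha, ha1, hb1, hab⟩ := exists_Ioo_of_isCompact hK hK0
  let ζ : ℝ → ℝ := (Set.Ioo a b).indicator 1
  have hi : Integrable (fun x => ζ ‖x‖ * F x) := by
    have h1 : IntegrableOn F (Metric.closedBall 0 b) :=
      hF.integrableOn_isCompact (isCompact_closedBall 0 b)
    have hm : MeasurableSet {x : E | ‖x‖ ∈ Set.Ioo a b} :=
      measurableSet_Ioo.preimage measurable_norm
    have h2 : IntegrableOn F {x : E | ‖x‖ ∈ Set.Ioo a b} :=
      h1.mono_set fun x hx => by simpa using hx.2.le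
    refine (h2.integrable_indicator hm).congr (Eventually.of_forall fun x => ?_)
    by_cases hx : ‖x‖ ∈ Set.Ioo a b
    · rw [Set.indicator_of_mem (by exact hx)]
      simp [ζ, Set.indicator_of_mem hx]
    · rw [Set.indicator_of_notMem (by exact hx)]
      simp [ζ, Set.indicator_of_notMem hx]
  have h3 := ((integral_polar hi).1.mono_set hK0).continuousOn_mul
    (g := fun r => (r ^ (Module.finrank ℝ E - 1))⁻¹)
    ((continuousOn_pow _).inv₀ fun r hr => (pow_pos (hK0 hr) _).ne') hK
  refine h3.congr_fun (fun r hr => ?_) hK.measurableSet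
  have hr0 : 0 < r := hK0 hr
  simp only
  rw [sphereInt_norm_mul ζ F hr0, ← mul_assoc, inv_mul_cancel₀ (pow_pos hr0 _).ne', one_mul]
  simp [ζ, Set.indicator_of_mem (hab hr)]

/-- The profile of a locally integrable radial function is locally integrable. -/
theorem locallyIntegrableOn_profile {g : ℝ → ℝ} (hg : LocallyIntegrable fun x : E => g ‖x‖) :
    LocallyIntegrableOn g (Set.Ioi 0) := by
  have h1 := (locallyIntegrableOn_sphereInt hg).smul
    ((volume : Measure E).toSphere.real Set.univ)⁻¹
  rw [locallyIntegrableOn_iff isOpen_Ioi.isLocallyClosed] at h1 ⊢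
  intro K hK0 hK
  refine (h1 K hK0 hK).congr_fun (fun r hr => ?_) hK.measurableSet
  have := (toSphere_real_univ_pos (E := E)).ne'
  simp only [Pi.smul_apply, smul_eq_mul]
  rw [sphereInt_norm g (hK0 hr)]
  field_simp

end Polar

/-! ### Radial test functions -/

section RadialTest

theorem eventuallyEq_zero_comp_norm {E : Type*} [NormedAddCommGroup E] {ζ : ℝ → ℝ}
    (hζ : IsHalfLineTest ζ) :
    (fun x : E => ζ ‖x‖) =ᶠ[𝓝 0] fun _ => 0 := by
  have h0 : (0 : ℝ) ∉ tsupport ζ := fun h => lt_irrefl (0 : ℝ) (hζ.2.2 h)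
  have h1 : ζ =ᶠ[𝓝 ‖(0 : E)‖] 0 := by
    rw [norm_zero]; exact notMem_tsupport_iff_eventuallyEq.1 h0
  exact (continuous_norm.tendsto (0 : E)).eventually h1

variable {E : Type*} [NormedAddCommGroup E] [InnerProductSpace ℝ E]

theorem contDiff_comp_norm {ζ : ℝ → ℝ} (hζ : IsHalfLineTest ζ) :
    ContDiff ℝ ∞ (fun x : E => ζ ‖x‖) := by
  rw [contDiff_iff_contDiffAt]
  intro x
  rcases eq_or_ne x 0 with rfl | hx
  · exact contDiffAt_const.congr_of_eventuallyEq (eventuallyEq_zero_comp_norm hζ)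
  · exact hζ.1.contDiffAt.comp x (contDiffAt_norm ℝ hx)

/-- At the origin both sides vanish. -/
theorem fderiv_comp_norm {ζ : ℝ → ℝ} (hζ : IsHalfLineTest ζ) (x v : E) :
    fderiv ℝ (fun x : E => ζ ‖x‖) x v = deriv ζ ‖x‖ * (inner ℝ x v / ‖x‖) := by
  rcases eq_or_ne x 0 with rfl | hx
  · rw [(eventuallyEq_zero_comp_norm hζ).fderiv_eq]; simp
  · have hn : HasFDerivAt (fun x : E => ‖x‖) (‖x‖⁻¹ • innerSL ℝ x) x := by
      have h1 := (hasStrictFDerivAt_norm_sq x).hasFDerivAt.sqrt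
        (pow_ne_zero 2 (norm_ne_zero_iff.2 hx))
      simp only [Real.sqrt_sq (norm_nonneg _)] at h1
      refine h1.congr_fderiv ?_
      ext w; simp; field_simp
    have h2 := ((hζ.1.differentiable (by simp)).differentiableAt.hasDerivAt
      (x := ‖x‖)).comp_hasFDerivAt x hn
    rw [show (fun x : E => ζ ‖x‖) = ζ ∘ fun x : E => ‖x‖ from rfl, h2.fderiv]
    simp only [smul_apply, coe_innerSL_apply, smul_eq_mul]
    ring

variable [FiniteDimensional ℝ E]

theorem hasCompactSupport_comp_norm {ζ : ℝ → ℝ} (hζ : IsHalfLineTest ζ) :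
    HasCompactSupport (fun x : E => ζ ‖x‖) := by
  obtain ⟨a, b, -, -, -, hab⟩ := hζ.exists_Ioo
  refine HasCompactSupport.intro (isCompact_closedBall (0 : E) b) fun x hx => ?_
  refine eq_zero_of_tsupport_subset hab fun h => hx ?_
  simpa using h.2.le

end RadialTest

/-! ### Absolute continuity of the radial profile -/

section WeakGradient

variable {N : ℕ}

theorem IsHalfLineTest.mul_inv_pow {ζ : ℝ → ℝ} (hζ : IsHalfLineTest ζ) (k : ℕ) :
    IsHalfLineTest fun r => ζ r * (r ^ k)⁻¹ := by
  refine ⟨?_, hζ.2.1.mul_right, (tsupport_mul_subset_left (f := ζ)).trans hζ.2.2⟩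
  rw [contDiff_iff_contDiffAt]
  intro r
  by_cases hr : r ∈ tsupport ζ
  · have hr0 : 0 < r := hζ.2.2 hr
    exact hζ.1.contDiffAt.mul ((contDiffAt_id.pow k).inv (pow_pos hr0 k).ne')
  · refine contDiffAt_const (c := 0) |>.congr_of_eventuallyEq ?_
    filter_upwards [notMem_tsupport_iff_eventuallyEq.1 hr] with x hx
    rw [hx]; simp

theorem fderiv_comp_norm_mul_coord {η : ℝ → ℝ} (hη : IsHalfLineTest η) (i : Fin N)
    (x : EuclideanSpace ℝ (Fin N)) :
    fderiv ℝ (fun x : EuclideanSpace ℝ (Fin N) => η ‖x‖ * x i) x (EuclideanSpace.single i 1) =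
      deriv η ‖x‖ * (x i ^ 2 / ‖x‖) + η ‖x‖ := by
  have h1 : DifferentiableAt ℝ (fun x : EuclideanSpace ℝ (Fin N) => η ‖x‖) x :=
    ((contDiff_comp_norm hη).differentiable (by simp)).differentiableAt
  have h2 : HasFDerivAt (fun x : EuclideanSpace ℝ (Fin N) => x i)
      (EuclideanSpace.proj i : EuclideanSpace ℝ (Fin N) →L[ℝ] ℝ) x :=
    (EuclideanSpace.proj i : EuclideanSpace ℝ (Fin N) →L[ℝ] ℝ).hasFDerivAt
  rw [(h1.hasFDerivAt.fun_mul h2).fderiv]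
  simp only [add_apply, smul_apply, smul_eq_mul,
    fderiv_comp_norm hη, EuclideanSpace.inner_single_right]
  simp
  ring

/-- The divergence theorem for the radial vector field `η(|x|) x`, tested against `u`. -/
theorem integral_divergence_radial {u : EuclideanSpace ℝ (Fin N) → ℝ}
    {G : EuclideanSpace ℝ (Fin N) → EuclideanSpace ℝ (Fin N)} (hG : HasWeakGradient u G)
    {η : ℝ → ℝ} (hη : IsHalfLineTest η) :
    ∫ x, u x * (deriv η ‖x‖ * ‖x‖ + N * η ‖x‖) = -∫ x, η ‖x‖ * inner ℝ (G x) x := by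
  obtain ⟨hu, hGl, hw⟩ := hG
  have htest : ∀ i : Fin N, IsTestFunction fun x : EuclideanSpace ℝ (Fin N) => η ‖x‖ * x i :=
    fun i =>
    ⟨(contDiff_comp_norm hη).mul
      (EuclideanSpace.proj i : EuclideanSpace ℝ (Fin N) →L[ℝ] ℝ).contDiff,
      (hasCompactSupport_comp_norm hη).mul_right⟩
  have h1 : ∀ x : EuclideanSpace ℝ (Fin N), ∑ i, u x *
      fderiv ℝ (fun x : EuclideanSpace ℝ (Fin N) => η ‖x‖ * x i) x (EuclideanSpace.single i 1) =
      u x * (deriv η ‖x‖ * ‖x‖ + N * η ‖x‖) := fun x => by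
    rw [← Finset.mul_sum]
    congr 1
    simp only [fderiv_comp_norm_mul_coord hη]
    rw [Finset.sum_add_distrib, ← Finset.mul_sum, ← Finset.sum_div]
    have : ∑ i, x i ^ 2 = ‖x‖ ^ 2 := by
      rw [EuclideanSpace.norm_sq_eq]; simp
    rw [this]
    simp only [Finset.sum_const, Finset.card_univ, Fintype.card_fin, nsmul_eq_mul]
    rcases eq_or_ne ‖x‖ 0 with h | h
    · rw [h]; simp
    · rw [pow_two, mul_div_cancel_right₀ _ h]
  have h2 : ∀ x : EuclideanSpace ℝ (Fin N),
      ∑ i, inner ℝ (G x) (EuclideanSpace.single i 1) * (η ‖x‖ * x i) =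
      η ‖x‖ * inner ℝ (G x) x := fun x => by
    rw [PiLp.inner_apply, Finset.mul_sum]
    refine Finset.sum_congr rfl fun i _ => ?_
    rw [EuclideanSpace.inner_single_right]
    simp
    ring
  simp only [← h1, ← h2]
  rw [integral_finsetSum, integral_finsetSum, ← Finset.sum_neg_distrib]
  · exact Finset.sum_congr rfl fun i _ => hw _ (htest i) _
  · intro i _
    have hGi : LocallyIntegrable fun x => inner ℝ (G x) (EuclideanSpace.single i (1 : ℝ)) := by
      intro x
      obtain ⟨s, hs, hs'⟩ := hGl x
      exact ⟨s, hs, hs'.inner_const _⟩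
    exact hGi.integrable_smul_right_of_hasCompactSupport (htest i).1.continuous (htest i).2
  · intro i _
    exact hu.integrable_smul_right_of_hasCompactSupport
      (((htest i).1.continuous_fderiv_apply (by simp)).comp
        (continuous_id.prodMk continuous_const))
      ((htest i).2.fderiv_apply ℝ _)

theorem locallyIntegrable_inner_self {G : EuclideanSpace ℝ (Fin N) → EuclideanSpace ℝ (Fin N)}
    (hG : LocallyIntegrable G) :
    LocallyIntegrable fun x => (inner ℝ (G x) x : ℝ) := by
  rw [locallyIntegrable_iff]
  intro K hK
  have h1 : ∀ i : Fin N, IntegrableOn (fun x => G x i * x i) K := fun i =>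
    IntegrableOn.mul_continuousOn
      ((EuclideanSpace.proj i : EuclideanSpace ℝ (Fin N) →L[ℝ] ℝ).integrable_comp
        (hG.integrableOn_isCompact hK))
      (EuclideanSpace.proj i : EuclideanSpace ℝ (Fin N) →L[ℝ] ℝ).continuous.continuousOn hK
  have h2 := integrable_finsetSum Finset.univ fun i _ => h1 i
  refine h2.congr (Eventually.of_forall fun x => ?_)
  beta_reduce
  rw [PiLp.inner_apply]
  refine Finset.sum_congr rfl fun i _ => ?_
  simp
  ring

variable [Nontrivial (EuclideanSpace ℝ (Fin N))]

/-- The radial derivative of a radial Sobolev function: the spherical mean of the radial component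
of its gradient. -/
noncomputable def radialDeriv (G : EuclideanSpace ℝ (Fin N) → EuclideanSpace ℝ (Fin N)) (r : ℝ) :
    ℝ :=
  ((volume : Measure (EuclideanSpace ℝ (Fin N))).toSphere.real Set.univ)⁻¹ *
    (r⁻¹ * sphereInt (fun x => inner ℝ (G x) x) r)

theorem locallyIntegrableOn_radialDeriv {G : EuclideanSpace ℝ (Fin N) → EuclideanSpace ℝ (Fin N)}
    (hG : LocallyIntegrable G) :
    LocallyIntegrableOn (radialDeriv G) (Set.Ioi 0) := by
  have h1 := (locallyIntegrableOn_sphereInt (locallyIntegrable_inner_self hG))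
  rw [locallyIntegrableOn_iff isOpen_Ioi.isLocallyClosed] at h1 ⊢
  intro K hK0 hK
  exact ((h1 K hK0 hK).continuousOn_mul (g := fun r => r⁻¹)
    (continuousOn_id.inv₀ fun r hr => (ne_of_gt (hK0 hr))) hK).const_mul _

/-- The profile of a radial Sobolev function is absolutely continuous. -/
theorem exists_profile_eq_primitive {u : EuclideanSpace ℝ (Fin N) → ℝ}
    {G : EuclideanSpace ℝ (Fin N) → EuclideanSpace ℝ (Fin N)} (hG : HasWeakGradient u G)
    {g : ℝ → ℝ} (hg : ∀ᵐ x : EuclideanSpace ℝ (Fin N), u x = g ‖x‖) :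
    ∃ c, ∀ᵐ r, 0 < r → g r = c + primitive (radialDeriv G) r := by
  have hN : N - 1 + 1 = N := by
    have := Module.finrank_pos (R := ℝ) (M := EuclideanSpace ℝ (Fin N))
    rw [finrank_euclideanSpace_fin] at this
    omega
  have hgl : LocallyIntegrableOn g (Set.Ioi 0) := by
    refine locallyIntegrableOn_profile (E := EuclideanSpace ℝ (Fin N)) ?_
    intro x
    obtain ⟨s, hs, hs'⟩ := hG.1 x
    exact ⟨s, hs, hs'.congr (ae_restrict_of_ae hg)⟩
  refine exists_eq_primitive hgl (locallyIntegrableOn_radialDeriv hG.2.1) fun ζ hζ _ => ?_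
  -- for `η = r^(-N) ζ` the divergence of `η(|x|) x` is `|x|^(1-N) ζ'(|x|)`
  have hη := hζ.mul_inv_pow N
  have hdiv := integral_divergence_radial hG hη
  set σ := (volume : Measure (EuclideanSpace ℝ (Fin N))).toSphere.real Set.univ with hσ
  have hσ0 : σ ≠ 0 := (toSphere_real_univ_pos (E := EuclideanSpace ℝ (Fin N))).ne'
  have hL : ∫ x, u x * (deriv (fun r => ζ r * (r ^ N)⁻¹) ‖x‖ * ‖x‖ + N * (ζ ‖x‖ * (‖x‖ ^ N)⁻¹)) =
      σ * ∫ r in Set.Ioi 0, g r * deriv ζ r := by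
    have hpol := integral_norm_polar (E := EuclideanSpace ℝ (Fin N)) fun r => g r *
      (deriv (fun r => ζ r * (r ^ N)⁻¹) r * r + N * (ζ r * (r ^ N)⁻¹))
    rw [finrank_euclideanSpace_fin] at hpol
    refine (integral_congr_ae ?_).trans (hpol.trans ?_)
    · filter_upwards [hg] with x hx
      rw [hx]
    congr 1
    refine setIntegral_congr_fun measurableSet_Ioi fun r (hr : 0 < r) => ?_
    have hd : deriv (fun r => ζ r * (r ^ N)⁻¹) r =
        deriv ζ r * (r ^ N)⁻¹ + ζ r * (-(N * r ^ (N - 1)) / (r ^ N) ^ 2) :=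
      ((hζ.1.differentiable (by simp)).differentiableAt.hasDerivAt.fun_mul
        ((hasDerivAt_pow N r).fun_inv (pow_pos hr N).ne')).deriv
    have hrN : r ^ N = r ^ (N - 1) * r := by rw [← pow_succ, hN]
    have hp : r ^ (N - 1) ≠ 0 := (pow_pos hr _).ne'
    simp only [hd]
    rw [hrN]
    field_simp
    ring
  have hR : ∫ x : EuclideanSpace ℝ (Fin N), ζ ‖x‖ * (‖x‖ ^ N)⁻¹ * inner ℝ (G x) x =
      σ * ∫ r in Set.Ioi 0, radialDeriv G r * ζ r := by
    obtain ⟨a, b, -, -, -, hab⟩ := hη.exists_Ioo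
    rw [(integral_polar (integrable_norm_mul_of_locallyIntegrable
      (locallyIntegrable_inner_self hG.2.1) hη.1.continuous (b := b)
      fun r hr => eq_zero_of_tsupport_subset hab fun h => not_lt.2 hr h.2)).2, ← integral_const_mul,
      finrank_euclideanSpace_fin]
    refine setIntegral_congr_fun measurableSet_Ioi fun r (hr : 0 < r) => ?_
    simp only
    rw [sphereInt_norm_mul (fun r => ζ r * (r ^ N)⁻¹) _ hr, radialDeriv, ← hσ]
    have hrN : r ^ N = r ^ (N - 1) * r := by rw [← pow_succ, hN]
    have hp : r ^ (N - 1) ≠ 0 := (pow_pos hr _).ne'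
    rw [hrN]
    field_simp
  rw [hL, hR, ← mul_neg] at hdiv
  exact mul_left_cancel₀ hσ0 hdiv

end WeakGradient

/-! ### The weak gradient of a radial function -/

section RadialGradient

theorem integral_polar_norm_mul {E : Type*} [NormedAddCommGroup E] [InnerProductSpace ℝ E]
    [FiniteDimensional ℝ E] [MeasurableSpace E] [BorelSpace E] [Nontrivial E] {ζ : ℝ → ℝ}
    {F : E → ℝ} (h : Integrable fun x => ζ ‖x‖ * F x) :
    ∫ x, ζ ‖x‖ * F x =
      ∫ r in Set.Ioi 0, ζ r * (r ^ (Module.finrank ℝ E - 1) * sphereInt F r) := by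
  rw [(integral_polar h).2]
  refine setIntegral_congr_fun measurableSet_Ioi fun r (hr : 0 < r) => ?_
  rw [sphereInt_norm_mul ζ F hr]
  ring

/-- A factor `h(|x|)` may be singular at the origin if the other factor is supported in an
annulus. -/
theorem integrable_norm_mul {E : Type*} [NormedAddCommGroup E] [InnerProductSpace ℝ E]
    [FiniteDimensional ℝ E] [MeasurableSpace E] [BorelSpace E] [Nontrivial E] {h : ℝ → ℝ}
    (hh : LocallyIntegrableOn h (Set.Ioi 0)) {F : E → ℝ} (hF : Continuous F) {a b : ℝ}
    (ha : 0 < a) (hF0 : ∀ x, ‖x‖ ∉ Set.Ioo a b → F x = 0) :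
    Integrable fun x => h ‖x‖ * F x := by
  have hsub : Set.Icc a b ⊆ Set.Ioi 0 := fun x hx => ha.trans_le hx.1
  have h1 : Integrable fun x : E => (Set.Icc a b).indicator h ‖x‖ := by
    rw [integrable_fun_norm_addHaar]
    have h2 : IntegrableOn (fun r => r ^ (Module.finrank ℝ E - 1) * h r) (Set.Icc a b) :=
      (hh.integrableOn_compact_subset hsub isCompact_Icc).continuousOn_mul
        (continuousOn_pow _) isCompact_Icc
    refine ((h2.integrable_indicator measurableSet_Icc).integrableOn (s := Set.Ioi 0)).congr ?_
    refine Eventually.of_forall fun r => ?_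
    by_cases hr : r ∈ Set.Icc a b
    · simp only [Set.indicator_of_mem hr, smul_eq_mul]
    · simp only [Set.indicator_of_notMem hr, smul_eq_mul, mul_zero]
  have h3 : HasCompactSupport F := by
    refine HasCompactSupport.intro (isCompact_closedBall (0 : E) b) fun x hx => hF0 x fun h => hx ?_
    simpa using h.2.le
  refine (h1.locallyIntegrable.integrable_smul_right_of_hasCompactSupport hF h3).congr
    (Eventually.of_forall fun x => ?_)
  by_cases hx : ‖x‖ ∈ Set.Ioo a b
  · simp only [Set.indicator_of_mem (Set.Ioo_subset_Icc_self hx), smul_eq_mul]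
  · simp only [hF0 x hx, smul_zero, mul_zero]

variable {N : ℕ}

theorem exists_Ioo_norm_of_tsupport {E : Type*} [NormedAddCommGroup E] {φ : E → ℝ}
    (hφ : HasCompactSupport φ) (h0 : tsupport φ ⊆ {0}ᶜ) :
    ∃ a b : ℝ, 0 < a ∧ a < 1 ∧ 1 < b ∧ ∀ x ∈ tsupport φ, ‖x‖ ∈ Set.Ioo a b := by
  obtain ⟨a, b, ha, ha1, hb1, hab⟩ := exists_Ioo_of_isCompact (hφ.image continuous_norm) (by
    rintro _ ⟨x, hx, rfl⟩
    exact norm_pos_iff.2 (h0 hx))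
  exact ⟨a, b, ha, ha1, hb1, fun x hx => hab ⟨x, hx, rfl⟩⟩

theorem IsHalfLineTest.deriv {ζ : ℝ → ℝ} (hζ : IsHalfLineTest ζ) : IsHalfLineTest (deriv ζ) :=
  ⟨(contDiff_infty_iff_deriv.1 hζ.1).2, hζ.2.1.deriv, (tsupport_deriv_subset).trans hζ.2.2⟩

variable [Nontrivial (EuclideanSpace ℝ (Fin N))]

/-- The weak gradient of the radial function `g(|x|)` is `g'(|x|) x / |x|`, away from the origin.
In polar coordinates this is a one-dimensional integration by parts, because
`r ↦ ∫_{|x| = r} φ (x · v) / |x|` has the derivative `r ↦ ∫_{|x| = r} ∂_v φ`. -/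
theorem integral_radial_mul_fderiv {g h : ℝ → ℝ} {c : ℝ} (hh : LocallyIntegrableOn h (Set.Ioi 0))
    (hg : ∀ᵐ r, 0 < r → g r = c + primitive h r) {φ : EuclideanSpace ℝ (Fin N) → ℝ}
    (hφ : IsTestFunction φ) (hφ0 : tsupport φ ⊆ {0}ᶜ) (v : EuclideanSpace ℝ (Fin N)) :
    ∫ x, g ‖x‖ * fderiv ℝ φ x v = -∫ x, h ‖x‖ * (inner ℝ x v / ‖x‖ * φ x) := by
  obtain ⟨a, b, ha, ha1, hb1, hab⟩ := exists_Ioo_norm_of_tsupport hφ.2 hφ0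
  have hφz : ∀ x, ‖x‖ ∉ Set.Ioo a b → φ x = 0 := fun x hx =>
    image_eq_zero_of_notMem_tsupport fun h' => hx (hab x h')
  have hφ'z : ∀ x, ‖x‖ ∉ Set.Ioo a b → fderiv ℝ φ x v = 0 := fun x hx => by
    have : fderiv ℝ φ x = 0 := by
      by_contra h'
      exact hx (hab x (support_fderiv_subset ℝ h'))
    rw [this]; rfl
  set F : EuclideanSpace ℝ (Fin N) → ℝ := fun x => inner ℝ x v / ‖x‖ * φ x with hF
  set F' : EuclideanSpace ℝ (Fin N) → ℝ := fun x => fderiv ℝ φ x v with hF'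
  have hFz : ∀ x, ‖x‖ ∉ Set.Ioo a b → F x = 0 := fun x hx => by
    simp only [hF, hφz x hx, mul_zero]
  have hFc : Continuous F := by
    rw [continuous_iff_continuousAt]
    intro x
    rcases eq_or_ne x 0 with rfl | hx
    · have h1 : φ =ᶠ[𝓝 0] 0 :=
        notMem_tsupport_iff_eventuallyEq.1 fun h' => hφ0 h' rfl
      refine (continuousAt_const (y := (0 : ℝ))).congr ?_
      filter_upwards [h1] with y hy
      simp [hF, hy]
    · exact ((continuousAt_id.inner continuousAt_const).div continuous_norm.continuousAt
        (norm_ne_zero_iff.2 hx)).mul hφ.1.continuous.continuousAt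
  have hF'c : Continuous F' :=
    (hφ.1.continuous_fderiv_apply (by simp)).comp (continuous_id.prodMk continuous_const)
  have hgl : LocallyIntegrableOn g (Set.Ioi 0) := by
    have h1 : LocallyIntegrableOn (fun r => c + primitive h r) (Set.Ioi 0) :=
      ((continuous_const.locallyIntegrable).locallyIntegrableOn _).add
        (locallyIntegrableOn_primitive hh)
    intro r hr
    obtain ⟨s, hs, hs'⟩ := h1 r hr
    refine ⟨s ∩ Set.Ioi 0, inter_mem hs self_mem_nhdsWithin,
      (hs'.mono_set Set.inter_subset_left).congr ?_⟩
    filter_upwards [ae_restrict_of_ae hg,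
      ae_restrict_of_ae_restrict_of_subset Set.inter_subset_right
        (ae_restrict_mem measurableSet_Ioi)] with t ht ht'
    exact (ht ht').symm
  set k := Module.finrank ℝ (EuclideanSpace ℝ (Fin N)) - 1 with hk
  set A : ℝ → ℝ := fun r => r ^ k * sphereInt F' r with hA
  set B : ℝ → ℝ := fun r => r ^ k * sphereInt F r with hB
  have hAl : LocallyIntegrableOn A (Set.Ioi 0) :=
    (integral_polar (hF'c.integrable_of_hasCompactSupport
      (hφ.2.fderiv_apply ℝ v))).1.locallyIntegrableOn
  have hFint : Integrable F := by
    refine hFc.integrable_of_hasCompactSupport ?_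
    exact hφ.2.mul_left
  have hBl : LocallyIntegrableOn B (Set.Ioi 0) := (integral_polar hFint).1.locallyIntegrableOn
  have hAz : ∀ r, 0 < r → r ∉ Set.Ioo a b → A r = 0 := fun r hr hr' => by
    simp only [hA]
    rw [sphereInt_eq_zero hr fun x hx => hφ'z x (by rwa [hx]), mul_zero]
  have hBz : ∀ r, 0 < r → r ∉ Set.Ioo a b → B r = 0 := fun r hr hr' => by
    simp only [hB]
    rw [sphereInt_eq_zero hr fun x hx => hFz x (by rwa [hx]), mul_zero]
  obtain ⟨c', hc'⟩ := exists_eq_primitive hBl hAl fun ζ hζ _ => by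
    have h1 : ∫ x, ζ ‖x‖ * F' x = -∫ x, _root_.deriv ζ ‖x‖ * F x := by
      have h2 := integral_mul_fderiv_eq_neg_fderiv_mul_of_integrable (μ := volume)
        (f := fun x : EuclideanSpace ℝ (Fin N) => ζ ‖x‖) (g := φ) (v := v) ?_ ?_ ?_ ?_ ?_
      · rw [h2]
        congr 2; ext x
        rw [fderiv_comp_norm hζ, hF]; ring
      · have := (contDiff_comp_norm hζ).continuous_fderiv_apply (E := EuclideanSpace ℝ (Fin N))
          (by simp)
        exact ((this.comp (continuous_id.prodMk continuous_const)).mul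
          hφ.1.continuous).integrable_of_hasCompactSupport hφ.2.mul_left
      · exact ((contDiff_comp_norm hζ).continuous.mul hF'c).integrable_of_hasCompactSupport
          (hφ.2.fderiv_apply ℝ v).mul_left
      · exact ((contDiff_comp_norm hζ).continuous.mul
          hφ.1.continuous).integrable_of_hasCompactSupport hφ.2.mul_left
      · exact fun x _ => (contDiff_comp_norm hζ).differentiable (by simp) x
      · exact fun x _ => hφ.1.differentiable (by simp) x
    rw [integral_polar_norm_mul (((contDiff_comp_norm hζ).continuous.mul
        hF'c).integrable_of_hasCompactSupport (hφ.2.fderiv_apply ℝ v).mul_left),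
      integral_polar_norm_mul (((contDiff_comp_norm hζ.deriv).continuous.mul
        hFc).integrable_of_hasCompactSupport (hφ.2.mul_left.mul_left))] at h1
    simp only [hA, hB, mul_comm _ (ζ _), mul_comm _ (_root_.deriv ζ _)]
    linarith
  have hcp : ContinuousOn (fun r => c' + primitive A r) (Set.Ioi 0) :=
    continuousOn_const.add (continuousOn_primitive hAl)
  -- off the support of `φ` the primitive representing `B` vanishes by continuity
  have hzero : ∀ U : Set ℝ, IsOpen U → U ⊆ Set.Ioi 0 → (∀ r ∈ U, r ∉ Set.Ioo a b) →
      ∀ r ∈ U, c' + primitive A r = 0 := by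
    intro U hU hU0 hUab
    refine Measure.eqOn_open_of_ae_eq (μ := volume) (f := fun r => c' + primitive A r)
      (g := fun _ => (0 : ℝ)) ?_ hU (hcp.mono hU0) continuousOn_const
    filter_upwards [ae_restrict_of_ae hc', ae_restrict_mem hU.measurableSet] with r hr hrU
    rw [← hr (hU0 hrU), hBz r (hU0 hrU) (hUab r hrU)]
  have hmain := integral_primitive_mul (a := a / 2) (b := b + 1) hh hAl hg hc' (by linarith)
    (by linarith) (by linarith) ?_ ?_ ?_
  · rw [integral_polar_norm_mul (integrable_norm_mul hgl hF'c ha hφ'z),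
      integral_polar_norm_mul (integrable_norm_mul hh hFc ha hFz)]
    exact hmain
  · intro r hr hr'
    rcases lt_or_ge r a with h1 | h1
    · exact hzero (Set.Ioo 0 a) isOpen_Ioo (fun x hx => hx.1)
        (fun x hx h' => not_lt.2 hx.2.le h'.1) r ⟨hr, h1⟩
    · have h2 : b < r := by
        by_contra! h3
        exact hr' ⟨by linarith, by linarith⟩
      exact hzero (Set.Ioi b) isOpen_Ioi (fun x hx => lt_trans (by linarith : (0 : ℝ) < b) hx)
        (fun x hx h' => not_lt.2 (le_of_lt hx) h'.2) r h2
  · exact fun r hr hr' => hBz r hr fun h' => hr' ⟨by linarith [h'.1], by linarith [h'.2]⟩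
  · exact fun r hr hr' => hAz r hr fun h' => hr' ⟨by linarith [h'.1], by linarith [h'.2]⟩

/-- The weak gradient of a radial function is radial. -/
theorem weakGradient_eq_radial {u : EuclideanSpace ℝ (Fin N) → ℝ}
    {G : EuclideanSpace ℝ (Fin N) → EuclideanSpace ℝ (Fin N)} (hG : HasWeakGradient u G)
    {g h : ℝ → ℝ} {c : ℝ} (hu : ∀ᵐ x, u x = g ‖x‖) (hh : LocallyIntegrableOn h (Set.Ioi 0))
    (hg : ∀ᵐ r, 0 < r → g r = c + primitive h r) :
    ∀ᵐ x, G x = (h ‖x‖ / ‖x‖) • x := by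
  have hcoord : ∀ i : Fin N, ∀ᵐ x, x ∈ ({0}ᶜ : Set (EuclideanSpace ℝ (Fin N))) →
      G x i - h ‖x‖ * (x i / ‖x‖) = 0 := by
    intro i
    have hGi : LocallyIntegrable fun x => G x i := fun x => by
      obtain ⟨s, hs, hs'⟩ := hG.2.1 x
      exact ⟨s, hs, (EuclideanSpace.proj i : EuclideanSpace ℝ (Fin N) →L[ℝ] ℝ).integrable_comp hs'⟩
    have hHi : LocallyIntegrableOn (fun x => h ‖x‖ * (x i / ‖x‖))
        ({0}ᶜ : Set (EuclideanSpace ℝ (Fin N))) := by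
      rw [locallyIntegrableOn_iff isOpen_compl_singleton.isLocallyClosed]
      intro K hK0 hK
      obtain ⟨χ, hχ1, hχ3, hχ4⟩ :
          ∃ χ : ℝ → ℝ, Continuous χ ∧ (∃ a b : ℝ, 0 < a ∧ ∀ r, r ∉ Set.Ioo a b → χ r = 0) ∧
            ∀ x ∈ K, χ ‖x‖ = 1 := by
        obtain ⟨a, b, ha, ha1, hb1, hab⟩ := exists_Ioo_of_isCompact (hK.image continuous_norm) (by
          rintro _ ⟨x, hx, rfl⟩
          exact norm_pos_iff.2 (hK0 hx))
        let D : ContDiffBump ((a + b) / 2) :=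
          ⟨(b - a) / 2, (b - a) / 2 + a / 2, by linarith, by linarith⟩
        refine ⟨D, D.continuous, ⟨a / 2, b + a / 2, by linarith, fun r hr => ?_⟩,
          fun x hx => ?_⟩
        · refine D.zero_of_le_dist ?_
          change (b - a) / 2 + a / 2 ≤ _
          rw [Real.dist_eq]
          by_contra! h'
          rw [abs_lt] at h'
          exact hr ⟨by linarith, by linarith⟩
        · refine D.one_of_mem_closedBall ?_
          rw [Real.closedBall_eq_Icc]
          change ‖x‖ ∈ Set.Icc ((a + b) / 2 - (b - a) / 2) ((a + b) / 2 + (b - a) / 2)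
          have hx' : ‖x‖ ∈ Set.Ioo a b := hab ⟨x, hx, rfl⟩
          exact ⟨by linarith [hx'.1], by linarith [hx'.2]⟩
      obtain ⟨a, b, ha, hab⟩ := hχ3
      have h1 : Integrable fun x : EuclideanSpace ℝ (Fin N) => h ‖x‖ * (χ ‖x‖ * (x i / ‖x‖)) := by
        refine integrable_norm_mul hh ?_ ha fun x hx => by rw [hab _ hx, zero_mul]
        rw [continuous_iff_continuousAt]
        intro x
        rcases eq_or_ne x 0 with rfl | hx
        · refine (continuousAt_const (y := (0 : ℝ))).congr ?_
          filter_upwards [Metric.ball_mem_nhds (0 : EuclideanSpace ℝ (Fin N)) ha] with y hy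
          rw [hab ‖y‖ fun h' => not_lt.2 h'.1.le (by simpa using hy), zero_mul]
        · exact (hχ1.comp continuous_norm).continuousAt.mul
            ((EuclideanSpace.proj i : EuclideanSpace ℝ (Fin N) →L[ℝ] ℝ).continuous.continuousAt.div
              continuous_norm.continuousAt (norm_ne_zero_iff.2 hx))
      refine h1.integrableOn.congr_fun (fun x hx => ?_) hK.measurableSet
      simp only [hχ4 x hx, one_mul]
    refine isOpen_compl_singleton.ae_eq_zero_of_integral_contDiff_smul_eq_zero
      ((hGi.locallyIntegrableOn _).sub hHi) ?_
    intro φ hφ1 hφ2 hφ3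
    have hφ : IsTestFunction φ := ⟨hφ1, hφ2⟩
    have h1 := hG.2.2 φ hφ (EuclideanSpace.single i 1)
    have h2 := integral_radial_mul_fderiv hh hg hφ hφ3 (EuclideanSpace.single i 1)
    have h3 : ∫ x, u x * fderiv ℝ φ x (EuclideanSpace.single i 1) =
        ∫ x, g ‖x‖ * fderiv ℝ φ x (EuclideanSpace.single i 1) :=
      integral_congr_ae (by filter_upwards [hu] with x hx; rw [hx])
    rw [h3, h2, neg_inj] at h1
    simp only [EuclideanSpace.inner_single_right, one_mul, conj_trivial] at h1
    have hi1 : Integrable fun x => G x i * φ x :=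
      hGi.integrable_smul_right_of_hasCompactSupport hφ1.continuous hφ2
    have hi2 : Integrable fun x => h ‖x‖ * (x i / ‖x‖ * φ x) := by
      have h4 := hHi.integrableOn_compact_subset hφ3 hφ2
      have h5 := h4.mul_continuousOn hφ1.continuous.continuousOn hφ2
      rw [integrableOn_iff_integrable_of_support_subset] at h5
      · exact h5.congr (Eventually.of_forall fun x => by simp only; ring)
      · intro x hx
        by_contra h'
        exact hx (by simp only [image_eq_zero_of_notMem_tsupport h', mul_zero])
    calc ∫ x, φ x • (G x i - h ‖x‖ * (x i / ‖x‖))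
        = ∫ x, (G x i * φ x - h ‖x‖ * (x i / ‖x‖ * φ x)) := by
          congr 1; ext x; rw [smul_eq_mul]; ring
      _ = 0 := by rw [integral_sub hi1 hi2, h1, sub_self]
  have hne : ∀ᵐ x : EuclideanSpace ℝ (Fin N), x ∈ ({0}ᶜ : Set (EuclideanSpace ℝ (Fin N))) := by
    rw [ae_iff]
    simp
  filter_upwards [ae_all_iff.2 hcoord, hne] with x hx hx0
  ext i
  have := hx i hx0
  simp only [PiLp.smul_apply, smul_eq_mul]
  linarith [show h ‖x‖ * (x i / ‖x‖) = h ‖x‖ / ‖x‖ * x i by ring]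

end RadialGradient

/-! ### The radial equation -/

section RadialEquation

theorem hasDerivAt_primitive {l : ℝ → ℝ} (hl : ContinuousOn l (Set.Ioi 0)) {r : ℝ} (hr : 0 < r) :
    HasDerivAt (primitive l) (l r) r :=
  intervalIntegral.integral_hasDerivAt_right
    (intervalIntegrable_of_locallyIntegrableOn (hl.locallyIntegrableOn measurableSet_Ioi)
      one_pos hr)
    (hl.stronglyMeasurableAtFilter isOpen_Ioi r hr) (hl.continuousAt (Ioi_mem_nhds hr))

theorem primitive_congr_ae {l l' : ℝ → ℝ} (h : ∀ᵐ r, 0 < r → l r = l' r) {r : ℝ} (hr : 0 < r) :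
    primitive l r = primitive l' r := by
  refine intervalIntegral.integral_congr_ae ?_
  filter_upwards [h] with t ht htr
  exact ht ((lt_min one_pos hr).trans htr.1)

theorem nonneg_of_ae_pos {g : ℝ → ℝ} (hg : ContinuousOn g (Set.Ioi 0))
    (hae : ∀ᵐ r, 0 < r → 0 < g r) {r : ℝ} (hr : 0 < r) : 0 ≤ g r := by
  have h1 : Set.EqOn (fun r => |g r|) g (Set.Ioi 0) := by
    refine Measure.eqOn_open_of_ae_eq (μ := volume) ?_ isOpen_Ioi hg.abs hg
    filter_upwards [ae_restrict_of_ae hae, ae_restrict_mem measurableSet_Ioi] with t ht ht0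
    exact abs_of_pos (ht ht0)
  rw [← h1 hr]
  exact abs_nonneg _

variable {N : ℕ}

theorem rpow_sub_one_eq_pow (hN : 1 ≤ N) {r : ℝ} : r ^ ((N : ℝ) - 1) = r ^ (N - 1) := by
  rw [← Real.rpow_natCast, Nat.cast_sub hN, Nat.cast_one]

/-- The right-hand side of the radial equation `-(r^(n-1) |g'|^(p-2) g')' = r^(n-1) ρ`. -/
noncomputable def radialRhs (p μ m : ℝ) (f g : ℝ → ℝ) (r : ℝ) : ℝ :=
  μ / r ^ p * g r ^ (p - 1) - m * g r ^ (p - 1) + f (g r)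

theorem continuousOn_radialRhs {p μ m : ℝ} (hp : 1 < p) {f g : ℝ → ℝ} (hf : Continuous f)
    (hg : ContinuousOn g (Set.Ioi 0)) : ContinuousOn (radialRhs p μ m f g) (Set.Ioi 0) := by
  have h1 : ContinuousOn (fun r => g r ^ (p - 1)) (Set.Ioi 0) :=
    hg.rpow_const fun _ _ => Or.inr (by linarith)
  have h2 : ContinuousOn (fun r : ℝ => μ / r ^ p) (Set.Ioi 0) :=
    continuousOn_const.div (continuousOn_id.rpow_const fun r hr => Or.inl (ne_of_gt hr))
      fun r hr => (Real.rpow_pos_of_pos hr p).ne'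
  exact ((h2.mul h1).sub (continuousOn_const.mul h1)).add (hf.comp_continuousOn hg)

variable [Nontrivial (EuclideanSpace ℝ (Fin N))]

theorem one_le_dim : 1 ≤ N := by
  have := Module.finrank_pos (R := ℝ) (M := EuclideanSpace ℝ (Fin N))
  rwa [finrank_euclideanSpace_fin] at this

/-- Testing the equation with radial functions. -/
theorem integral_flux_mul_deriv {p μ m : ℝ} (hp : 1 < p) {f : ℝ → ℝ} (hf : Continuous f)
    {u : EuclideanSpace ℝ (Fin N) → ℝ} (hu : IsWeakSolution p μ m f u)
    {G : EuclideanSpace ℝ (Fin N) → EuclideanSpace ℝ (Fin N)} (hG : HasWeakGradient u G)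
    {g h : ℝ → ℝ} (hug : ∀ᵐ x, u x = g ‖x‖) (hGh : ∀ᵐ x, G x = (h ‖x‖ / ‖x‖) • x)
    (hg : ContinuousOn g (Set.Ioi 0)) (hgpos : ∀ᵐ r, 0 < r → 0 < g r)
    (hh : LocallyIntegrableOn (fun r => r ^ (N - 1) * spow (p - 1) (h r)) (Set.Ioi 0))
    {ζ : ℝ → ℝ} (hζ : IsHalfLineTest ζ) (hζ0 : ∀ r, 0 ≤ ζ r) :
    ∫ r in Set.Ioi 0, r ^ (N - 1) * spow (p - 1) (h r) * deriv ζ r =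
      -∫ r in Set.Ioi 0, -(r ^ (N - 1) * radialRhs p μ m f g r) * ζ r := by
  have hp1 : p - 1 ≠ 0 := by linarith
  set φ : EuclideanSpace ℝ (Fin N) → ℝ := fun x => ζ ‖x‖ with hφ
  have hφt : IsTestFunction φ := ⟨contDiff_comp_norm hζ, hasCompactSupport_comp_norm hζ⟩
  have heq : weakForm p μ m u G φ = ∫ x, f (u x) * φ x :=
    le_antisymm (hu.1.2 G hG φ hφt fun x => hζ0 _) (hu.2.2 G hG φ hφt fun x => hζ0 _)
  set σ := (volume : Measure (EuclideanSpace ℝ (Fin N))).toSphere.real Set.univ with hσ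
  have hσ0 : σ ≠ 0 := (toSphere_real_univ_pos (E := EuclideanSpace ℝ (Fin N))).ne'
  have hgpos' := (ae_norm_iff (E := EuclideanSpace ℝ (Fin N))
    (Q := fun r => 0 < r → 0 < g r)).2 (hgpos.mono fun r h _ => h)
  have hne : ∀ᵐ x : EuclideanSpace ℝ (Fin N), x ≠ 0 := by
    rw [ae_iff]; simp
  let Q : ℝ → ℝ := fun r => spow (p - 1) (h r) * deriv ζ r -
    (μ / r ^ p * g r ^ (p - 1) - m * g r ^ (p - 1)) * ζ r
  have hleft : weakForm p μ m u G φ = σ * ∫ r in Set.Ioi 0, r ^ (N - 1) * Q r := by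
    have hpol := integral_norm_polar (E := EuclideanSpace ℝ (Fin N)) Q
    rw [finrank_euclideanSpace_fin] at hpol
    rw [← hpol, weakForm]
    refine integral_congr_ae ?_
    filter_upwards [hug, hGh, hgpos', hne] with x h1 h2 h3 h4
    have hx : 0 < ‖x‖ := norm_pos_iff.2 h4
    have hgx := h3 hx
    have e1 : ‖G x‖ = |h ‖x‖| := by
      rw [h2, norm_smul, norm_div, norm_norm, Real.norm_eq_abs, div_mul_cancel₀ _ hx.ne']
    have e2 : fderiv ℝ φ x (G x) = deriv ζ ‖x‖ * h ‖x‖ := by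
      rw [hφ, fderiv_comp_norm hζ, h2, inner_smul_right, real_inner_self_eq_norm_sq]
      field_simp
    have e3 : |h ‖x‖| ^ (p - 2) * h ‖x‖ = spow (p - 1) (h ‖x‖) := by
      rw [spow_eq hp1]; congr 2; ring
    have e4 : |u x| ^ (p - 2) * u x = g ‖x‖ ^ (p - 1) := by
      rw [← spow_of_nonneg hp1 hgx.le, spow_eq hp1, h1]; congr 2; ring
    have e5 : φ x = ζ ‖x‖ := rfl
    simp only [e1, e2, e4, e5, Q]
    rw [← e3]; ring
  have hright : ∫ x, f (u x) * φ x = σ * ∫ r in Set.Ioi 0, r ^ (N - 1) * (f (g r) * ζ r) := by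
    have hpol := integral_norm_polar (E := EuclideanSpace ℝ (Fin N)) fun r => f (g r) * ζ r
    rw [finrank_euclideanSpace_fin] at hpol
    rw [← hpol]
    refine integral_congr_ae ?_
    filter_upwards [hug] with x h1
    rw [h1]
  rw [hleft, hright] at heq
  have heq' := mul_left_cancel₀ hσ0 heq
  have hgp : ContinuousOn (fun r => g r ^ (p - 1)) (Set.Ioi 0) :=
    hg.rpow_const fun _ _ => Or.inr (by linarith)
  have hlin : LocallyIntegrableOn (fun r => r ^ (N - 1) *
      (μ / r ^ p * g r ^ (p - 1) - m * g r ^ (p - 1))) (Set.Ioi 0) := by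
    refine ContinuousOn.locallyIntegrableOn ?_ measurableSet_Ioi
    have h2 : ContinuousOn (fun r : ℝ => μ / r ^ p) (Set.Ioi 0) :=
      continuousOn_const.div (continuousOn_id.rpow_const fun r hr => Or.inl (ne_of_gt hr))
        fun r hr => (Real.rpow_pos_of_pos hr p).ne'
    exact (continuousOn_pow _).mul ((h2.mul hgp).sub (continuousOn_const.mul hgp))
  have hnl : LocallyIntegrableOn (fun r => r ^ (N - 1) * f (g r)) (Set.Ioi 0) :=
    ((continuousOn_pow _).mul (hf.comp_continuousOn hg)).locallyIntegrableOn measurableSet_Ioi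
  have i1 := hζ.integrableOn_mul_deriv hh
  have i2 := hζ.integrableOn_mul hlin
  have i3 := hζ.integrableOn_mul hnl
  have e1 : ∫ r in Set.Ioi 0, r ^ (N - 1) * Q r =
      (∫ r in Set.Ioi 0, r ^ (N - 1) * spow (p - 1) (h r) * deriv ζ r) -
      ∫ r in Set.Ioi 0, r ^ (N - 1) *
        (μ / r ^ p * g r ^ (p - 1) - m * g r ^ (p - 1)) * ζ r := by
    rw [← integral_sub i1 i2]
    congr 1; ext r; simp only [Q]; ring
  have e2 : ∫ r in Set.Ioi 0, -(r ^ (N - 1) * radialRhs p μ m f g r) * ζ r =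
      -((∫ r in Set.Ioi 0, r ^ (N - 1) *
        (μ / r ^ p * g r ^ (p - 1) - m * g r ^ (p - 1)) * ζ r) +
        ∫ r in Set.Ioi 0, r ^ (N - 1) * f (g r) * ζ r) := by
    rw [← integral_add i2 i3, ← integral_neg]
    congr 1; ext r; simp only [radialRhs]; ring
  have e3 : ∫ r in Set.Ioi 0, r ^ (N - 1) * (f (g r) * ζ r) =
      ∫ r in Set.Ioi 0, r ^ (N - 1) * f (g r) * ζ r := by
    congr 1; ext r; ring
  rw [e1, e3] at heq'
  rw [e2]
  linarith

/-- The energy of a radial function in polar coordinates. -/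
theorem integrableOn_energy {p : ℝ} (hp : 1 < p)
    {G : EuclideanSpace ℝ (Fin N) → EuclideanSpace ℝ (Fin N)} (hG : MemLp G (ENNReal.ofReal p))
    {h : ℝ → ℝ} (hGh : ∀ᵐ x, G x = (h ‖x‖ / ‖x‖) • x) :
    IntegrableOn (fun r => r ^ (N - 1) * |h r| ^ p) (Set.Ioi 0) := by
  have h1 := hG.integrable_norm_rpow (by simp; linarith) ENNReal.ofReal_ne_top
  rw [ENNReal.toReal_ofReal (by linarith)] at h1
  have hne : ∀ᵐ x : EuclideanSpace ℝ (Fin N), x ≠ 0 := by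
    rw [ae_iff]; simp
  have h2 : Integrable fun x : EuclideanSpace ℝ (Fin N) => |h ‖x‖| ^ p := by
    refine h1.congr ?_
    filter_upwards [hGh, hne] with x h2 h4
    have hx : 0 < ‖x‖ := norm_pos_iff.2 h4
    rw [h2, norm_smul, norm_div, norm_norm, Real.norm_eq_abs, div_mul_cancel₀ _ hx.ne']
  have h3 := (integrable_fun_norm_addHaar (volume : Measure (EuclideanSpace ℝ (Fin N)))
    (f := fun r => |h r| ^ p)).1 h2
  rw [finrank_euclideanSpace_fin] at h3
  exact h3

/-- `|h|^(p-1) ≤ 1 + |h|^p`. -/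
theorem locallyIntegrableOn_flux {p : ℝ} (hp : 1 < p) {k : ℕ} {h : ℝ → ℝ}
    (hh : LocallyIntegrableOn h (Set.Ioi 0))
    (hE : IntegrableOn (fun r => r ^ k * |h r| ^ p) (Set.Ioi 0)) :
    LocallyIntegrableOn (fun r => r ^ k * spow (p - 1) (h r)) (Set.Ioi 0) := by
  have hp1 : 0 < p - 1 := by linarith
  rw [locallyIntegrableOn_iff isOpen_Ioi.isLocallyClosed]
  intro K hK0 hK
  have h1 : IntegrableOn (fun r => r ^ k + r ^ k * |h r| ^ p) K :=
    ((continuousOn_pow k).integrableOn_compact hK).add (hE.mono_set hK0)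
  refine h1.mono' ?_ ?_
  · exact (continuous_pow k).aestronglyMeasurable.mul
      ((continuous_spow hp1).comp_aestronglyMeasurable
        (hh.integrableOn_compact_subset hK0 hK).aestronglyMeasurable)
  · filter_upwards [ae_restrict_mem hK.measurableSet] with r hr
    have hr0 : 0 < r := hK0 hr
    have hrk : 0 < r ^ k := pow_pos hr0 k
    rw [norm_mul, Real.norm_eq_abs, Real.norm_eq_abs, abs_spow hp1.ne', abs_of_pos hrk]
    have h2 : |h r| ^ (p - 1) ≤ 1 + |h r| ^ p := by
      rcases le_total |h r| 1 with h3 | h3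
      · have := Real.rpow_le_one (abs_nonneg _) h3 hp1.le
        have := Real.rpow_nonneg (abs_nonneg (h r)) p
        linarith
      · have := Real.rpow_le_rpow_of_exponent_le h3 (by linarith : p - 1 ≤ p)
        linarith
    have := mul_le_mul_of_nonneg_left h2 hrk.le
    linarith

/-- A positive radial weak solution has a profile of class `C¹` with a flux of class `C¹`, and
the equation holds pointwise for it. -/
theorem exists_radial_solution {p μ m : ℝ} (hp : 1 < p) {f : ℝ → ℝ} (hf : Continuous f)
    {u : EuclideanSpace ℝ (Fin N) → ℝ} (hu : IsWeakSolution p μ m f u)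
    (hpos : ∀ᵐ x, 0 < u x) (hrad : IsRadial u) :
    ∃ g d W : ℝ → ℝ, (∀ᵐ x, u x = g ‖x‖) ∧ (∀ r, 0 < r → 0 ≤ g r) ∧
      (∀ᵐ r, 0 < r → 0 < g r) ∧ (∀ r, 0 < r → HasDerivAt g (d r) r) ∧
      ContinuousOn d (Set.Ioi 0) ∧
      (∀ r, 0 < r → W r = r ^ ((N : ℝ) - 1) * spow (p - 1) (d r)) ∧
      (∀ r, 0 < r → HasDerivAt W (-(r ^ ((N : ℝ) - 1) * radialRhs p μ m f g r)) r) ∧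
      IntegrableOn (fun r => r ^ ((N : ℝ) - 1) * |d r| ^ p) (Set.Ioi 0) := by
  have hp1 : 0 < p - 1 := by linarith
  obtain ⟨g₀, hg₀⟩ := hrad
  obtain ⟨G, hG, hGp⟩ := hu.1.1.2
  obtain ⟨c, hc⟩ := exists_profile_eq_primitive hG hg₀
  set h := radialDeriv G with hh
  have hhl : LocallyIntegrableOn h (Set.Ioi 0) := locallyIntegrableOn_radialDeriv hG.2.1
  set g : ℝ → ℝ := fun r => c + primitive h r with hg
  have hgc : ContinuousOn g (Set.Ioi 0) := continuousOn_const.add (continuousOn_primitive hhl)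
  have hne : ∀ᵐ x : EuclideanSpace ℝ (Fin N), x ≠ 0 := by
    rw [ae_iff]; simp
  have hug : ∀ᵐ x, u x = g ‖x‖ := by
    have h1 := (ae_norm_iff (E := EuclideanSpace ℝ (Fin N))
      (Q := fun r => 0 < r → g₀ r = g r)).2 (hc.mono fun r h _ => h)
    filter_upwards [hg₀, h1, hne] with x h2 h3 h4
    rw [h2, h3 (norm_pos_iff.2 h4)]
  have hgpos : ∀ᵐ r, 0 < r → 0 < g r := by
    refine (ae_norm_iff (E := EuclideanSpace ℝ (Fin N)) (Q := fun r => 0 < g r)).1 ?_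
    filter_upwards [hug, hpos] with x h1 h2
    rwa [← h1]
  have hGh : ∀ᵐ x, G x = (h ‖x‖ / ‖x‖) • x :=
    weakGradient_eq_radial hG hug hhl (Eventually.of_forall fun r _ => rfl)
  have hE := integrableOn_energy hp hGp hGh
  have hflux := locallyIntegrableOn_flux hp hhl hE
  have hρc : ContinuousOn (fun r => -(r ^ (N - 1) * radialRhs p μ m f g r)) (Set.Ioi 0) :=
    ((continuousOn_pow _).mul (continuousOn_radialRhs hp hf hgc)).neg
  obtain ⟨c₂, hc₂⟩ := exists_eq_primitive hflux (hρc.locallyIntegrableOn measurableSet_Ioi)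
    fun ζ hζ hζ0 => integral_flux_mul_deriv hp hf hu hG hug hGh hgc hgpos hflux hζ hζ0
  set W : ℝ → ℝ := fun r => c₂ + primitive (fun r => -(r ^ (N - 1) * radialRhs p μ m f g r)) r
    with hW
  have hWd : ∀ r, 0 < r → HasDerivAt W (-(r ^ (N - 1) * radialRhs p μ m f g r)) r := fun r hr =>
    (hasDerivAt_primitive hρc hr).const_add c₂
  -- inverting the signed power recovers the derivative from the continuously differentiable flux
  set d : ℝ → ℝ := fun r => spow (1 / (p - 1)) ((r ^ (N - 1))⁻¹ * W r) with hd
  have hdc : ContinuousOn d (Set.Ioi 0) := by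
    refine (continuous_spow (by positivity)).comp_continuousOn (ContinuousOn.mul ?_ ?_)
    · exact (continuousOn_pow _).inv₀ fun r hr => (pow_pos hr _).ne'
    · exact fun r hr => (hWd r hr).continuousAt.continuousWithinAt
  have hdh : ∀ᵐ r, 0 < r → h r = d r := by
    filter_upwards [hc₂] with r hr hr0
    simp only [hd, hW]
    rw [← hr hr0, ← mul_assoc, inv_mul_cancel₀ (pow_pos hr0 _).ne', one_mul, spow_inv_spow hp1.ne']
  have hN := one_le_dim (N := N)
  refine ⟨g, d, W, hug, fun r hr => nonneg_of_ae_pos hgc hgpos hr, hgpos, fun r hr => ?_, hdc,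
    fun r hr => ?_, fun r hr => ?_, ?_⟩
  · refine ((hasDerivAt_primitive hdc hr).const_add c).congr_of_eventuallyEq ?_
    filter_upwards [lt_mem_nhds hr] with t ht
    simp only [hg, primitive_congr_ae hdh ht]
  · simp only [hd]
    rw [spow_spow_inv hp1.ne', rpow_sub_one_eq_pow hN, ← mul_assoc,
      mul_inv_cancel₀ (pow_pos hr _).ne', one_mul]
  · rw [rpow_sub_one_eq_pow hN]; exact hWd r hr
  · refine hE.congr ?_
    filter_upwards [ae_restrict_of_ae hdh, ae_restrict_mem measurableSet_Ioi] with r hr hr0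
    rw [rpow_sub_one_eq_pow hN, hr hr0]

end RadialEquation

/-! ### The nonlinearity and the characteristic equation -/

theorem eventually_abs_le_of_limsup {f : ℝ → ℝ} {l : Filter ℝ} {e A : ℝ}
    (h : limsup (fun t : ℝ => ((|f t| / |t| ^ e : ℝ) : EReal)) l ≤ (A : EReal)) :
    ∀ᶠ t in l, t ≠ 0 → |f t| ≤ (A + 1) * |t| ^ e := by
  have h1 : limsup (fun t : ℝ => ((|f t| / |t| ^ e : ℝ) : EReal)) l < ((A + 1 : ℝ) : EReal) :=
    h.trans_lt (EReal.coe_lt_coe_iff.2 (by linarith))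
  filter_upwards [eventually_lt_of_limsup_lt h1] with t ht ht0
  have h2 := EReal.coe_lt_coe_iff.1 ht
  rw [div_lt_iff₀ (Real.rpow_pos_of_pos (abs_pos.2 ht0) e)] at h2
  exact h2.le

/-- The growth conditions at zero and at infinity combine into a global bound. -/
theorem exists_growth_bound {p q s A : ℝ} (hp : 1 < p) (hq : p < q) (hs : p < s)
    {f : ℝ → ℝ} (hf : Continuous f) (hA : 0 < A)
    (hf0 : limsup (fun t : ℝ => ((|f t| / |t| ^ (q - 1) : ℝ) : EReal)) (𝓝[≠] 0) ≤ (A : EReal))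
    (hfinf : limsup (fun t : ℝ => ((|f t| / |t| ^ (s - 1) : ℝ) : EReal))
      (Bornology.cobounded ℝ) ≤ (A : EReal)) :
    ∃ C, 0 ≤ C ∧ ∀ t, 0 ≤ t → |f t| ≤ C * (t ^ (p - 1) + t ^ (s - 1)) := by
  have hp1 : 0 < p - 1 := by linarith
  have h0 := eventually_abs_le_of_limsup hf0
  have hinf := eventually_abs_le_of_limsup hfinf
  obtain ⟨δ, hδ, hδ'⟩ := Metric.eventually_nhds_iff.1 (eventually_nhdsWithin_iff.1 h0)
  have hinf' : ∀ᶠ t : ℝ in atTop, t ≠ 0 → |f t| ≤ (A + 1) * |t| ^ (s - 1) := by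
    rw [IsOrderBornology.cobounded_eq] at hinf
    exact (eventually_sup.1 hinf).2
  obtain ⟨R, hR⟩ := eventually_atTop.1 hinf'
  set δ₁ := min (δ / 2) 1 with hδ₁
  have hδ₁0 : 0 < δ₁ := by positivity
  obtain ⟨M, hM⟩ := isCompact_Icc.exists_bound_of_continuousOn (s := Set.Icc δ₁ R) hf.continuousOn
  set C := (A + 1) + |M| / δ₁ ^ (p - 1) with hC
  have hC1 : A + 1 ≤ C := by
    have : 0 ≤ |M| / δ₁ ^ (p - 1) := by positivity
    linarith
  have hpos : ∀ t, 0 < t → |f t| ≤ C * (t ^ (p - 1) + t ^ (s - 1)) := by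
    intro t ht
    have ht1 : 0 < t ^ (p - 1) := Real.rpow_pos_of_pos ht _
    have ht2 : 0 < t ^ (s - 1) := Real.rpow_pos_of_pos ht _
    rcases le_total t δ₁ with h | h
    · have h1 : |f t| ≤ (A + 1) * |t| ^ (q - 1) := by
        refine hδ' ?_ ht.ne' ht.ne'
        rw [Real.dist_0_eq_abs, abs_of_pos ht]
        have := min_le_left (δ / 2) 1
        linarith
      have h2 : t ^ (q - 1) ≤ t ^ (p - 1) :=
        Real.rpow_le_rpow_of_exponent_ge ht (h.trans (min_le_right _ _)) (by linarith)
      rw [abs_of_pos ht] at h1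
      calc |f t| ≤ (A + 1) * t ^ (q - 1) := h1
        _ ≤ C * t ^ (p - 1) := by gcongr
        _ ≤ _ := by
          gcongr
          linarith
    · rcases le_total R t with h' | h'
      · have h1 := hR t h' ht.ne'
        rw [abs_of_pos ht] at h1
        calc |f t| ≤ (A + 1) * t ^ (s - 1) := h1
          _ ≤ C * t ^ (s - 1) := by gcongr
          _ ≤ _ := by
            gcongr
            linarith
      · have h1 : |f t| ≤ |M| := (hM t ⟨h, h'⟩).trans (le_abs_self M)
        have h2 : δ₁ ^ (p - 1) ≤ t ^ (p - 1) := Real.rpow_le_rpow hδ₁0.le h hp1.le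
        have h3 : |M| / δ₁ ^ (p - 1) * δ₁ ^ (p - 1) = |M| :=
          div_mul_cancel₀ _ (Real.rpow_pos_of_pos hδ₁0 _).ne'
        calc |f t| ≤ |M| / δ₁ ^ (p - 1) * δ₁ ^ (p - 1) := by rw [h3]; exact h1
          _ ≤ C * t ^ (p - 1) := by
            gcongr
            linarith
          _ ≤ _ := by
            gcongr
            linarith
  refine ⟨C, by linarith, fun t ht => ?_⟩
  rcases ht.eq_or_lt with rfl | ht
  · have h1 : Tendsto (fun t : ℝ => |f t|) (𝓝[>] 0) (𝓝 |f 0|) :=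
      (hf.abs.tendsto 0).mono_left nhdsWithin_le_nhds
    have h2 : Tendsto (fun t : ℝ => C * (t ^ (p - 1) + t ^ (s - 1))) (𝓝[>] 0)
        (𝓝 (C * ((0 : ℝ) ^ (p - 1) + (0 : ℝ) ^ (s - 1)))) := by
      refine Tendsto.mono_left (Continuous.tendsto ?_ 0) nhdsWithin_le_nhds
      exact continuous_const.mul ((Real.continuous_rpow_const hp1.le).add
        (Real.continuous_rpow_const (by linarith)))
    refine le_of_tendsto_of_tendsto h1 h2 ?_
    filter_upwards [self_mem_nhdsWithin] with t ht using hpos t ht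
  · exact hpos t ht

/-- The smallest zero lies in `[0, (N-p)/p)` by the intermediate value theorem, because `Γ_μ` is
nonnegative at `0` and negative at `(N-p)/p`. -/
theorem exists_isLeast_root {N : ℕ} {p μ : ℝ} (hp : 1 < p) (hpN : p < N) (hμ : 0 ≤ μ)
    (hμbar : μ < ((N - p) / p) ^ p) :
    ∃ γ, IsLeast {γ : ℝ | 0 ≤ γ ∧ Gam N p μ γ = 0} γ ∧ γ < (N - p) / p := by
  have hp1 : 0 < p - 1 := by linarith
  set a := ((N : ℝ) - p) / p with ha
  have ha0 : 0 < a := div_pos (by linarith) (by linarith)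
  have hcont : Continuous (Gam N p μ) := by
    unfold Gam
    exact ((Real.continuous_rpow_const hp1.le).mul
      ((continuous_const.mul continuous_id).sub continuous_const)).add continuous_const
  have h0 : 0 ≤ Gam N p μ 0 := by
    simp [Gam, Real.zero_rpow hp1.ne', hμ]
  have h1 : Gam N p μ a < 0 := by
    rw [Gam, ← riccati_rpow hp ha0.le, ha, riccati_critical hp hpN]
    linarith
  obtain ⟨γ₀, hγ₀, hγ₀'⟩ := intermediate_value_Icc' ha0.le hcont.continuousOn ⟨h1.le, h0⟩
  have hclosed : IsClosed {γ : ℝ | 0 ≤ γ ∧ Gam N p μ γ = 0} :=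
    (isClosed_le continuous_const continuous_id).inter (isClosed_eq hcont continuous_const)
  have hleast := hclosed.isLeast_csInf ⟨γ₀, hγ₀.1, hγ₀'⟩ ⟨0, fun γ hγ => hγ.1⟩
  refine ⟨_, hleast, lt_of_le_of_ne ((hleast.2 ⟨hγ₀.1, hγ₀'⟩).trans hγ₀.2) fun h => ?_⟩
  have := hleast.1.2
  rw [h] at this
  linarith

end HardyPLaplace

theorem theorem1p1 (N : ℕ) (p μ m q A : ℝ) (hp : 1 < p) (hpN : p < N)
    (hμ : 0 ≤ μ) (hμbar : μ < ((N - p) / p) ^ p)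
    (f : ℝ → ℝ) (hf : Continuous f) (hq : p < q) (hA : 0 < A)
    (hf0 : limsup (fun t : ℝ => ((|f t| / |t| ^ (q - 1) : ℝ) : EReal)) (𝓝[≠] 0) ≤ (A : EReal))
    (hfinf : limsup (fun t : ℝ => ((|f t| / |t| ^ (N * p / (N - p) - 1) : ℝ) : EReal))
      (Bornology.cobounded ℝ) ≤ (A : EReal))
    (u : EuclideanSpace ℝ (Fin N) → ℝ)
    (hu : HardyPLaplace.IsWeakSolution p μ m f u)
    (hpos : ∀ᵐ x : EuclideanSpace ℝ (Fin N), 0 < u x)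
    (hrad : HardyPLaplace.IsRadial u) :
    ∃ γ₁ : ℝ, IsLeast {γ : ℝ | 0 ≤ γ ∧ HardyPLaplace.Gam N p μ γ = 0} γ₁ ∧
      γ₁ < (N - p) / p ∧
      ∃ v : EuclideanSpace ℝ (Fin N) → ℝ,
        (∀ᵐ x : EuclideanSpace ℝ (Fin N), u x = v x) ∧ ContinuousOn v {0}ᶜ ∧
        ∃ C : ℝ, 0 < C ∧ Tendsto (fun x => v x * ‖x‖ ^ γ₁) (𝓝[≠] 0) (𝓝 C) := by
  open HardyPLaplace in
  have hp1 : 0 < p - 1 := by linarith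
  obtain ⟨γ₁, hγ₁, hγ₁a⟩ := exists_isLeast_root hp hpN hμ hμbar
  refine ⟨γ₁, hγ₁, hγ₁a, ?_⟩
  have hN0 : 0 < N := by
    have : (0 : ℝ) < N := by linarith
    exact_mod_cast this
  have : Nonempty (Fin N) := ⟨⟨0, hN0⟩⟩
  have : Nontrivial (EuclideanSpace ℝ (Fin N)) := inferInstance
  have hps : p < N * p / (N - p) := by
    rw [lt_div_iff₀ (by linarith)]
    nlinarith
  obtain ⟨C₀, hC₀, hfC⟩ := exists_growth_bound hp hq hps hf hA hf0 hfinf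
  obtain ⟨g, d, W, hug, hg0, hgae, hgd, hdc, hWd, hW, hint⟩ :=
    exists_radial_solution hp hf hu hpos hrad
  have hgc : ContinuousOn g (Set.Ioi 0) := fun r hr => (hgd r hr).continuousAt.continuousWithinAt
  have hgpos : ∀ r, 0 < r → 0 < g r := by
    refine pos_of_radial_solution hp hpN hg0 hgae hgd hWd hW fun a b ha => ?_
    have hsub : Set.Icc a b ⊆ Set.Ioi 0 := fun x hx => ha.trans_le hx.1
    obtain ⟨M, hM⟩ := isCompact_Icc.exists_bound_of_continuousOn (hgc.mono hsub)
    refine ⟨μ / a ^ p + |m| + C₀ * (1 + |M| ^ (N * p / (N - p) - p)), fun r hr => ?_⟩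
    have hr0 : 0 < r := hsub hr
    have hgr := hg0 r hr0
    have hgM : g r ≤ |M| := (le_abs_self _).trans ((hM r hr).trans (le_abs_self M))
    have hgp : 0 ≤ g r ^ (p - 1) := Real.rpow_nonneg hgr _
    have e1 : g r ^ (N * p / (N - p) - 1) ≤ g r ^ (p - 1) * |M| ^ (N * p / (N - p) - p) := by
      rw [show N * p / (N - p) - 1 = (p - 1) + (N * p / (N - p) - p) by ring,
        Real.rpow_add_of_nonneg hgr hp1.le (by linarith)]
      exact mul_le_mul_of_nonneg_left (Real.rpow_le_rpow hgr hgM (by linarith)) hgp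
    have e2 : |μ / r ^ p * g r ^ (p - 1)| ≤ μ / a ^ p * g r ^ (p - 1) := by
      have hap : 0 < a ^ p := Real.rpow_pos_of_pos ha p
      have har : a ^ p ≤ r ^ p := Real.rpow_le_rpow ha.le hr.1 (by linarith)
      have hrp : 0 < r ^ p := hap.trans_le har
      rw [abs_of_nonneg (by positivity)]
      gcongr
    have e3 : |m * g r ^ (p - 1)| = |m| * g r ^ (p - 1) := by rw [abs_mul, abs_of_nonneg hgp]
    have e4 : |f (g r)| ≤ C₀ * (1 + |M| ^ (N * p / (N - p) - p)) * g r ^ (p - 1) :=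
      (hfC _ hgr).trans (by
        have := mul_le_mul_of_nonneg_left e1 hC₀
        linarith)
    rw [radialRhs]
    have e5 := abs_add_le (μ / r ^ p * g r ^ (p - 1) - m * g r ^ (p - 1)) (f (g r))
    have e6 := abs_sub (μ / r ^ p * g r ^ (p - 1)) (m * g r ^ (p - 1))
    linarith
  obtain ⟨C, hC, hlim⟩ := radial_asymptotics hp hpN hμ hμbar hγ₁.1.1 hγ₁a hγ₁.1.2
    (fun t ht => hfC t ht.le) hgpos hgd hdc hWd hW
    (hint.mono_set fun r hr => hr.1)
  refine ⟨fun x => g ‖x‖, hug, ?_, C, hC, ?_⟩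
  · exact hgc.comp continuous_norm.continuousOn fun x hx => norm_pos_iff.2 hx
  · exact hlim.comp tendsto_norm_nhdsNE_zero
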